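/- Fix $n$ and $t>0$. Let $d\mu_t(z)=(\pi t)^{-n}e^{-|z|^2/t}\,dz$ on $\mathbb C^n$. For $1\le p<\infty$ let $F_t^p$ be the Banach space of entire functions on $\mathbb C^n$ with $$\|f\|_p^p=\Big(\frac{p}{2\pi t}\Big)^n\int_{\mathbb C^n}|f(z)|^pe^{-\frac{p}{2t}|z|^2}\,dz<\infty .$$ Let $F_t^\infty$ be the Banach space of entire functions with $\|f\|_\infty=\sup_z|f(z)|e^{-|z|^2/(2t)}<\infty$, and let $f_t^\infty\subset F_t^\infty$ be the closed subspace of those $f$ for which $f e^{-|\cdot|^2/(2t)}$ vanishes at infinity. Let $\mathbb F_t$ be any one of the spaces $F_t^p$ ($1\le p\le\infty$), $f_t^\infty$. Let $\mathcal W_t$ be the class of measurable $k:\mathbb C^n\times\mathbb C^n\to\mathbb C$ such that $k(w,z)$ is holomorphic in $z$, anti-holomorphic in $w$, and dominated by some non-negative $H\in L^1(\mathbb C^n)$, meaning that $$|k(w,z)|\le e^{\frac{|z|^2+|w|^2}{2t}}H(w-z)\qquad (w,z\in\mathbb C^n).$$ Let $\mathcal W_t(\mathbb F_t)$ be the set of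 bounded linear operators $A$ on $\mathbb F_t$ of the form $A=A_k$ with $k\in\mathcal W_t$, where $A_kf(z)=\int f(w)k(w,z)\,d\mu_t(w)$. For $z\in\mathbb C^n$ let $W_zg(w)=e^{\frac{w\cdot\overline z}{t}-\frac{|z|^2}{2t}}g(w-z)$ and $\alpha_z(A)=W_zAW_{-z}$. Let $\mathcal M$ be the maximal ideal space of the $C^*$-algebra of bounded uniformly continuous functions on $\mathbb C^n$. It contains $\mathbb C^n$ as the set of point evaluations; put $\partial\mathbb C^n=\mathcal M\setminus\mathbb C^n$. If $\mathbb F_t\neq F_t^\infty$, then $x\mapsto\alpha_x(A)$, $x\in\mathcal M$, denotes the extension of $z\mapsto\alpha_z(A)$ from $\mathbb C^n$ to $\mathcal M$ that is continuous for the strong operator topology. If $\mathbb F_t=F_t^\infty$, put $\alpha_x(A)=(\alpha_x(A|_{f_t^\infty}))^{**}$, using the dualities $(f_t^\infty)'\cong F_t^1$ and $(F_t^1)'\cong F_t^\infty$ given by $\langle f,g\rangle=\int f\overline g\,d\mu_t$. The operators $\alpha_x(A)$ with $x\in\partial\mathbb C^n$ are called the limit operators of $A$. **Lemma.** Let $A\in\mathcal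 W_t(\mathbb F_t)$. Then the family $(\alpha_x(A))_{x\in\mathcal M}$ exists and is unique, and $\alpha_x(A)\in\mathcal W_t(\mathbb F_t)$ for every $x\in\partial\mathbb C^n$. Moreover, if $A=A_k$ with $k\in\mathcal W_t$, then for every $x\in\partial\mathbb C^n$ there is $k_x\in\mathcal W_t$ with $\alpha_x(A)=A_{k_x}$ such that every non-negative $H\in L^1(\mathbb C^n)$ that dominates $k$ also dominates $k_x$. -/

import Mathlib

open MeasureTheory Filter Topology
open scoped ComplexConjugate BoundedContinuousFunction

noncomputable section

namespace Fock

/-- `ℂⁿ` with its Euclidean norm (and, through it, Lebesgue measure as `volume`). -/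
abbrev Cn (n : ℕ) : Type := EuclideanSpace ℂ (Fin n)

/-- The Gaussian probability measure `dμ_t(z) = (π t)⁻ⁿ exp(-|z|² / t) dz` on `ℂⁿ`. -/
def gaussian (n : ℕ) (t : ℝ) : Measure (Cn n) :=
  volume.withDensity fun z =>
    ENNReal.ofReal (((Real.pi * t) ^ n)⁻¹ * Real.exp (-‖z‖ ^ 2 / t))

/-! ### The Fock spaces -/

/-- Labels of the Fock spaces: `pow p` is `F_t^p` with `1 ≤ p < ∞`, `infty` is `F_t^∞`, and
`vanish` is `f_t^∞`. -/
inductive Kind : Type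
  | pow (p : ℝ) (hp : 1 ≤ p)
  | infty
  | vanish

/-- The growth condition that singles out each Fock space among the entire functions. -/
def Growth (n : ℕ) (t : ℝ) : Kind → (Cn n → ℂ) → Prop
  | .pow p _, f => Integrable (fun z : Cn n => ‖f z‖ ^ p * Real.exp (-(p / (2 * t)) * ‖z‖ ^ 2))
  | .infty, f => ∃ C : ℝ, ∀ z, ‖f z‖ * Real.exp (-‖z‖ ^ 2 / (2 * t)) ≤ C
  | .vanish, f =>
      Tendsto (fun z : Cn n => ‖f z‖ * Real.exp (-‖z‖ ^ 2 / (2 * t))) (cocompact (Cn n)) (𝓝 0)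

/-- The norm of each Fock space, as a function of the underlying function. -/
def fockNorm (n : ℕ) (t : ℝ) : Kind → (Cn n → ℂ) → ℝ
  | .pow p _, f => ((p / (2 * Real.pi * t)) ^ n *
      ∫ z : Cn n, ‖f z‖ ^ p * Real.exp (-(p / (2 * t)) * ‖z‖ ^ 2)) ^ (1 / p)
  | .infty, f => ⨆ z : Cn n, ‖f z‖ * Real.exp (-‖z‖ ^ 2 / (2 * t))
  | .vanish, f => ⨆ z : Cn n, ‖f z‖ * Real.exp (-‖z‖ ^ 2 / (2 * t))

/-- Auxiliary: the weighted function `f(z) exp(-|z|² / (2t))`. -/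
def weighted {n : ℕ} (t : ℝ) (f : Cn n → ℂ) (z : Cn n) : ℂ :=
  f z * (Real.exp (-‖z‖ ^ 2 / (2 * t)) : ℝ)

section aux

variable {n : ℕ} {t : ℝ} {f g : Cn n → ℂ}

theorem norm_weighted (z : Cn n) :
    ‖weighted t f z‖ = ‖f z‖ * Real.exp (-‖z‖ ^ 2 / (2 * t)) := by
  rw [weighted, norm_mul, Complex.norm_real, Real.norm_of_nonneg (Real.exp_nonneg _)]

theorem norm_weighted_rpow (p : ℝ) (z : Cn n) :
    ‖weighted t f z‖ ^ p = ‖f z‖ ^ p * Real.exp (-(p / (2 * t)) * ‖z‖ ^ 2) := by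
  rw [norm_weighted, Real.mul_rpow (norm_nonneg _) (Real.exp_nonneg _), ← Real.exp_mul]
  congr 2
  ring

theorem weighted_add : weighted t (f + g) = weighted t f + weighted t g := by
  funext z; simp [weighted, add_mul]

theorem weighted_smul (c : ℂ) : weighted t (c • f) = c • weighted t f := by
  funext z; simp [weighted, mul_assoc]

theorem continuous_weighted (hf : Differentiable ℂ f) : Continuous (weighted t f) := by
  have := hf.continuous
  unfold weighted
  fun_prop

theorem weighted_eq_zero (h : weighted t f = 0) : f = 0 := by
  funext z
  have := congrFun h z
  simpa [weighted] using this

theorem growth_pow_iff {p : ℝ} (hp : 1 ≤ p) (hf : Differentiable ℂ f) :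
    Growth n t (.pow p hp) f ↔ MemLp (weighted t f) (ENNReal.ofReal p) volume := by
  have h0 : 0 < p := by linarith
  rw [← integrable_norm_rpow_iff (continuous_weighted hf).aestronglyMeasurable
    (by simpa using h0) (by simp), ENNReal.toReal_ofReal h0.le]
  simp only [Growth, norm_weighted_rpow]

theorem fockNorm_pow_eq {p : ℝ} (hp : 1 ≤ p) (ht : 0 < t) (hf : Differentiable ℂ f)
    (hg : Growth n t (.pow p hp) f) :
    fockNorm n t (.pow p hp) f = ((p / (2 * Real.pi * t)) ^ n) ^ (1 / p) *
      (eLpNorm (weighted t f) (ENNReal.ofReal p) volume).toReal := by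
  have h0 : 0 < p := by linarith
  rw [((growth_pow_iff hp hf).1 hg).eLpNorm_eq_integral_rpow_norm (by simpa using h0) (by simp),
    ENNReal.toReal_ofReal h0.le]
  have h1 : 0 ≤ ∫ z : Cn n, ‖weighted t f z‖ ^ p := integral_nonneg fun z => by positivity
  rw [ENNReal.toReal_ofReal (by positivity)]
  simp only [fockNorm, ← norm_weighted_rpow]
  rw [Real.mul_rpow (by have := Real.pi_pos; positivity) h1, one_div]

theorem growth_infty_iff : Growth n t .infty f ↔ BddAbove (Set.range fun z => ‖weighted t f z‖) := by
  simp only [Growth, norm_weighted, BddAbove, Set.Nonempty, mem_upperBounds, Set.forall_mem_range]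

theorem growth_vanish_iff :
    Growth n t .vanish f ↔ Tendsto (weighted t f) (cocompact (Cn n)) (𝓝 0) := by
  rw [tendsto_zero_iff_norm_tendsto_zero]
  simp only [Growth, norm_weighted]

theorem Growth.infty_of_vanish (hf : Differentiable ℂ f) (h : Growth n t .vanish f) :
    Growth n t .infty f := by
  rw [growth_infty_iff]
  let F : ZeroAtInftyContinuousMap (Cn n) ℂ :=
    ⟨⟨weighted t f, continuous_weighted hf⟩, growth_vanish_iff.1 h⟩
  refine ⟨‖F.toBCF‖, ?_⟩
  rintro _ ⟨z, rfl⟩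
  exact F.toBCF.norm_coe_le_norm z

theorem Growth.add {κ : Kind} (hf : Differentiable ℂ f) (hg : Differentiable ℂ g)
    (h : Growth n t κ f) (h' : Growth n t κ g) : Growth n t κ (f + g) := by
  cases κ with
  | pow p hp =>
    rw [growth_pow_iff hp (hf.add hg), weighted_add]
    exact ((growth_pow_iff hp hf).1 h).add ((growth_pow_iff hp hg).1 h')
  | infty =>
    rw [growth_infty_iff] at *
    obtain ⟨C, hC⟩ := h
    obtain ⟨D, hD⟩ := h'
    refine ⟨C + D, ?_⟩
    rintro _ ⟨z, rfl⟩
    simp only [weighted_add, Pi.add_apply]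
    exact (norm_add_le _ _).trans (add_le_add (hC ⟨z, rfl⟩) (hD ⟨z, rfl⟩))
  | vanish =>
    rw [growth_vanish_iff] at *
    rw [weighted_add]
    have := Tendsto.add h h'
    rw [add_zero] at this
    exact this

theorem Growth.smul {κ : Kind} (c : ℂ) (hf : Differentiable ℂ f) (h : Growth n t κ f) :
    Growth n t κ (c • f) := by
  cases κ with
  | pow p hp =>
    rw [growth_pow_iff hp (hf.const_smul c), weighted_smul]
    exact ((growth_pow_iff hp hf).1 h).const_smul c
  | infty =>
    rw [growth_infty_iff] at *
    obtain ⟨C, hC⟩ := h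
    refine ⟨‖c‖ * C, ?_⟩
    rintro _ ⟨z, rfl⟩
    simp only [weighted_smul, Pi.smul_apply, norm_smul]
    exact mul_le_mul_of_nonneg_left (hC ⟨z, rfl⟩) (norm_nonneg _)
  | vanish =>
    rw [growth_vanish_iff] at *
    rw [weighted_smul]
    have := Tendsto.const_smul h c
    rw [smul_zero] at this
    exact this

theorem Growth.zero (κ : Kind) : Growth n t κ 0 := by
  cases κ with
  | pow p hp =>
    have h0 : p ≠ 0 := by linarith
    simp [Growth, Real.zero_rpow h0]
  | infty => exact ⟨0, by simp⟩
  | vanish => simpa [Growth] using tendsto_const_nhds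

end aux

/-- The entire functions satisfying the growth condition, as a space of functions. -/
def fockSubmodule (n : ℕ) (t : ℝ) (κ : Kind) : Submodule ℂ (Cn n → ℂ) where
  carrier := {f | Differentiable ℂ f ∧ Growth n t κ f}
  zero_mem' := ⟨differentiable_const (0 : ℂ), Growth.zero κ⟩
  add_mem' := fun hf hg => ⟨hf.1.add hg.1, hf.2.add hf.1 hg.1 hg.2⟩
  smul_mem' := fun c _ hf => ⟨hf.1.const_smul c, hf.2.smul c hf.1⟩

/-- The Fock space with label `κ`; a separate type, so that its topology is that of the norm
below and not that of pointwise convergence. -/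
def FockSpace (n : ℕ) (t : ℝ) (κ : Kind) : Type := fockSubmodule n t κ

namespace FockSpace

variable {n : ℕ} {t : ℝ} {κ : Kind}

instance : AddCommGroup (FockSpace n t κ) := inferInstanceAs (AddCommGroup (fockSubmodule n t κ))

instance : Module ℂ (FockSpace n t κ) := inferInstanceAs (Module ℂ (fockSubmodule n t κ))

instance : CoeFun (FockSpace n t κ) fun _ => Cn n → ℂ := ⟨fun f => f.1⟩

theorem differentiable (f : FockSpace n t κ) : Differentiable ℂ f := f.2.1

theorem growth (f : FockSpace n t κ) : Growth n t κ f := f.2.2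

theorem coe_add (f g : FockSpace n t κ) : (⇑(f + g) : Cn n → ℂ) = ⇑f + ⇑g := rfl

theorem coe_smul (c : ℂ) (f : FockSpace n t κ) : (⇑(c • f) : Cn n → ℂ) = c • ⇑f := rfl

theorem coe_zero : (⇑(0 : FockSpace n t κ) : Cn n → ℂ) = 0 := rfl

theorem ext {f g : FockSpace n t κ} (h : ∀ z, f z = g z) : f = g := Subtype.ext (funext h)

instance : Norm (FockSpace n t κ) := ⟨fun f => fockNorm n t κ f⟩

theorem norm_def (f : FockSpace n t κ) : ‖f‖ = fockNorm n t κ f := rfl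

theorem bddAbove_infty (f : FockSpace n t .infty) :
    BddAbove (Set.range fun z => ‖weighted t f z‖) := growth_infty_iff.1 f.growth

theorem bddAbove_vanish (f : FockSpace n t .vanish) :
    BddAbove (Set.range fun z => ‖weighted t f z‖) :=
  growth_infty_iff.1 (f.growth.infty_of_vanish f.differentiable)

theorem sup_add_le {u v : Cn n → ℂ} (hu : BddAbove (Set.range fun z => ‖u z‖))
    (hv : BddAbove (Set.range fun z => ‖v z‖)) :
    (⨆ z, ‖(u + v) z‖) ≤ (⨆ z, ‖u z‖) + ⨆ z, ‖v z‖ :=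
  ciSup_le fun z => (norm_add_le _ _).trans (add_le_add (le_ciSup hu z) (le_ciSup hv z))

theorem sup_smul (c : ℂ) (u : Cn n → ℂ) : (⨆ z, ‖(c • u) z‖) = ‖c‖ * ⨆ z, ‖u z‖ := by
  simp only [Pi.smul_apply, norm_smul]
  exact (Real.mul_iSup_of_nonneg (norm_nonneg c) _).symm

theorem sup_eq_zero {u : Cn n → ℂ} (hu : BddAbove (Set.range fun z => ‖u z‖))
    (h : (⨆ z, ‖u z‖) = 0) : u = 0 := by
  funext z
  exact norm_le_zero_iff.1 (h ▸ le_ciSup hu z)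

theorem core [ht : Fact (0 < t)] : NormedSpace.Core ℂ (FockSpace n t κ) where
  norm_nonneg f := by
    have ht' := ht.out
    have hpi := Real.pi_pos
    cases κ with
    | pow p hp =>
      have h0 : 0 < p := by linarith
      refine Real.rpow_nonneg (mul_nonneg (by positivity) (integral_nonneg fun z => ?_)) _
      positivity
    | infty => exact Real.iSup_nonneg fun z => by positivity
    | vanish => exact Real.iSup_nonneg fun z => by positivity
  norm_smul c f := by
    cases κ with
    | pow p hp =>
      rw [norm_def, norm_def, fockNorm_pow_eq hp ht.out (c • f).differentiable (c • f).growth,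
        fockNorm_pow_eq hp ht.out f.differentiable f.growth, coe_smul, weighted_smul,
        eLpNorm_const_smul, ENNReal.toReal_mul, toReal_enorm]
      ring
    | infty =>
      simp only [norm_def, fockNorm, ← norm_weighted, coe_smul, weighted_smul, sup_smul]
    | vanish =>
      simp only [norm_def, fockNorm, ← norm_weighted, coe_smul, weighted_smul, sup_smul]
  norm_triangle f g := by
    have ht' := ht.out
    have hpi := Real.pi_pos
    cases κ with
    | pow p hp =>
      have h0 : 0 < p := by linarith
      have hf := (growth_pow_iff hp f.differentiable).1 f.growth
      have hg := (growth_pow_iff hp g.differentiable).1 g.growth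
      rw [norm_def, norm_def, norm_def,
        fockNorm_pow_eq hp ht.out (f + g).differentiable (f + g).growth,
        fockNorm_pow_eq hp ht.out f.differentiable f.growth,
        fockNorm_pow_eq hp ht.out g.differentiable g.growth, coe_add, weighted_add, ← mul_add,
        ← ENNReal.toReal_add hf.2.ne hg.2.ne]
      refine mul_le_mul_of_nonneg_left ?_ (by positivity)
      exact ENNReal.toReal_mono (ENNReal.add_ne_top.2 ⟨hf.2.ne, hg.2.ne⟩)
        (eLpNorm_add_le hf.1 hg.1 (by simpa using hp))
    | infty =>
      simp only [norm_def, fockNorm, ← norm_weighted, coe_add, weighted_add]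
      exact sup_add_le f.bddAbove_infty g.bddAbove_infty
    | vanish =>
      simp only [norm_def, fockNorm, ← norm_weighted, coe_add, weighted_add]
      exact sup_add_le f.bddAbove_vanish g.bddAbove_vanish
  norm_eq_zero_iff f := by
    have ht' := ht.out
    have hpi := Real.pi_pos
    constructor
    · intro h
      refine Subtype.ext (weighted_eq_zero (t := t) ?_)
      cases κ with
      | pow p hp =>
        have h0 : 0 < p := by linarith
        have hf := (growth_pow_iff hp f.differentiable).1 f.growth
        rw [norm_def, fockNorm_pow_eq hp ht.out f.differentiable f.growth] at h
        have hc : ((p / (2 * Real.pi * t)) ^ n) ^ (1 / p) ≠ 0 := by positivity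
        have h1 := (mul_eq_zero.1 h).resolve_left hc
        have h2 := (ENNReal.toReal_eq_zero_iff _).1 h1 |>.resolve_right hf.2.ne
        rw [eLpNorm_eq_zero_iff hf.1 (by simpa using h0)] at h2
        exact Measure.eq_of_ae_eq h2 (continuous_weighted f.differentiable) continuous_zero
      | infty =>
        simp only [norm_def, fockNorm, ← norm_weighted] at h
        exact sup_eq_zero f.bddAbove_infty h
      | vanish =>
        simp only [norm_def, fockNorm, ← norm_weighted] at h
        exact sup_eq_zero f.bddAbove_vanish h
    · rintro rfl
      cases κ with
      | pow p hp =>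
        have h0 : p ≠ 0 := by linarith
        simp [norm_def, fockNorm, coe_zero, Real.zero_rpow h0, h0]
      | infty => simp [norm_def, fockNorm, coe_zero]
      | vanish => simp [norm_def, fockNorm, coe_zero]

instance [Fact (0 < t)] : NormedAddCommGroup (FockSpace n t κ) := NormedAddCommGroup.ofCore core

instance [Fact (0 < t)] : NormedSpace ℂ (FockSpace n t κ) := NormedSpace.ofCore core

end FockSpace

/-- The algebra `𝓛(𝔽_t)` of bounded linear operators on a Fock space. -/
abbrev Op (n : ℕ) (t : ℝ) [Fact (0 < t)] (κ : Kind) : Type := FockSpace n t κ →L[ℂ] FockSpace n t κ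

/-! ### Weyl operators and shifts of operators -/

/-- The normalized reproducing kernel
`k_z(w) = K_z(w) / ‖K_z‖ = exp (w · z̄ / t - |z|² / (2t))`, where `K_z(w) = exp (w · z̄ / t)`
and `w · z̄ = ∑ w_j z̄_j` is Mathlib's `inner ℂ z w`. -/
def normKernel {n : ℕ} (t : ℝ) (z w : Cn n) : ℂ :=
  Complex.exp (inner ℂ z w / (t : ℂ) - ((‖z‖ ^ 2 / (2 * t) : ℝ) : ℂ))

/-- `(W_z g)(w) = k_z(w) g(w - z)` on functions. -/
def weylFun {n : ℕ} (t : ℝ) (z : Cn n) (g : Cn n → ℂ) (w : Cn n) : ℂ :=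
  normKernel t z w * g (w - z)

section weyl

variable {n : ℕ} {t : ℝ} {g : Cn n → ℂ}

theorem norm_weighted_weylFun (ht : 0 < t) (z w : Cn n) :
    ‖weighted t (weylFun t z g) w‖ = ‖weighted t g (w - z)‖ := by
  rw [norm_weighted, norm_weighted, weylFun, norm_mul, normKernel, Complex.norm_exp,
    mul_comm _ ‖g (w - z)‖, mul_assoc, ← Real.exp_add]
  congr 2
  have h1 : ‖w - z‖ ^ 2 = ‖w‖ ^ 2 - 2 * (inner ℂ z w : ℂ).re + ‖z‖ ^ 2 := by
    have := @norm_sub_sq ℂ (Cn n) _ _ _ w z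
    rw [this, ← inner_re_symm]
    rfl
  rw [h1, Complex.sub_re, Complex.ofReal_re, Complex.div_ofReal_re]
  field_simp
  ring

theorem differentiable_weylFun (z : Cn n) (hg : Differentiable ℂ g) :
    Differentiable ℂ (weylFun t z g) := by
  have h1 : Differentiable ℂ fun w : Cn n => inner ℂ z w := (innerSL ℂ z).differentiable
  have h2 : Differentiable ℂ fun w : Cn n => g (w - z) :=
    hg.comp (differentiable_id.sub_const z)
  unfold weylFun normKernel
  simp only [div_eq_mul_inv]
  exact (((h1.mul_const _).sub_const _).cexp).mul h2

theorem Growth.weylFun (ht : 0 < t) {κ : Kind} (z : Cn n) (h : Growth n t κ g) :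
    Growth n t κ (weylFun t z g) := by
  cases κ with
  | pow p hp =>
    simp only [Growth, ← norm_weighted_rpow, norm_weighted_weylFun ht] at h ⊢
    exact h.comp_sub_right z
  | infty =>
    simp only [Growth, ← norm_weighted, norm_weighted_weylFun ht] at h ⊢
    exact h.imp fun C hC w => hC (w - z)
  | vanish =>
    simp only [Growth, ← norm_weighted, norm_weighted_weylFun ht] at h ⊢
    exact h.comp (Homeomorph.subRight z).isClosedEmbedding.tendsto_cocompact

theorem fockNorm_weylFun (ht : 0 < t) (κ : Kind) (z : Cn n) :
    fockNorm n t κ (weylFun t z g) = fockNorm n t κ g := by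
  cases κ with
  | pow p hp =>
    simp only [fockNorm, ← norm_weighted_rpow, norm_weighted_weylFun ht]
    rw [integral_sub_right_eq_self (fun w => ‖weighted t g w‖ ^ p)]
  | infty =>
    simp only [fockNorm, ← norm_weighted, norm_weighted_weylFun ht]
    exact (Equiv.subRight z).iSup_comp (g := fun w => ‖weighted t g w‖)
  | vanish =>
    simp only [fockNorm, ← norm_weighted, norm_weighted_weylFun ht]
    exact (Equiv.subRight z).iSup_comp (g := fun w => ‖weighted t g w‖)

end weyl

/-- The Weyl operator `W_z` as an isometry of a Fock space. -/
def weyl (n : ℕ) (t : ℝ) [ht : Fact (0 < t)] (κ : Kind) (z : Cn n) :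
    FockSpace n t κ →ₗᵢ[ℂ] FockSpace n t κ where
  toFun g := ⟨weylFun t z g, differentiable_weylFun z g.differentiable,
    g.growth.weylFun ht.out z⟩
  map_add' f g := FockSpace.ext fun w => mul_add (normKernel t z w) (f (w - z)) (g (w - z))
  map_smul' c g := FockSpace.ext fun w => mul_left_comm (normKernel t z w) c (g (w - z))
  norm_map' _ := fockNorm_weylFun ht.out κ z

/-- The shift `α_z(A) = W_z A W_{-z}` of an operator. -/
def shift {n : ℕ} {t : ℝ} [Fact (0 < t)] {κ : Kind} (z : Cn n) (A : Op n t κ) : Op n t κ :=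
  (weyl n t κ z).toContinuousLinearMap ∘L A ∘L (weyl n t κ (-z)).toContinuousLinearMap

/-! ### The Wiener algebra -/

/-- `H` is a non-negative integrable function with
`|k(w, z)| ≤ exp ((|z|² + |w|²) / (2t)) H(w - z)`. -/
structure Dominates {n : ℕ} (t : ℝ) (H : Cn n → ℝ) (k : Cn n → Cn n → ℂ) : Prop where
  nonneg : ∀ u, 0 ≤ H u
  integrable : Integrable H
  bound : ∀ w z, ‖k w z‖ ≤ Real.exp ((‖z‖ ^ 2 + ‖w‖ ^ 2) / (2 * t)) * H (w - z)

/-- The class `𝒲_t` of kernels `k(w, z)`. -/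
structure IsWienerKernel {n : ℕ} (t : ℝ) (k : Cn n → Cn n → ℂ) : Prop where
  measurable : Measurable (Function.uncurry k)
  holomorphic : ∀ w, Differentiable ℂ fun z => k w z
  antiholomorphic : ∀ z, Differentiable ℂ fun w => conj (k w z)
  dominated : ∃ H : Cn n → ℝ, Dominates t H k

/-- `A = A_k`, the integral operator `A f(z) = ∫ f(w) k(w, z) dμ_t(w)`. -/
def IsIntegralOp {n : ℕ} {t : ℝ} [Fact (0 < t)] {κ : Kind} (k : Cn n → Cn n → ℂ)
    (A : Op n t κ) : Prop :=
  ∀ (f : FockSpace n t κ) (z : Cn n), A f z = ∫ w, f w * k w z ∂(gaussian n t)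

/-- The class `𝒲_t(𝔽_t)` of operators. -/
def wienerOps (n : ℕ) (t : ℝ) [Fact (0 < t)] (κ : Kind) : Set (Op n t κ) :=
  {A | ∃ k, IsWienerKernel t k ∧ IsIntegralOp k A}

/-! ### The maximal ideal space of `BUC(ℂⁿ)` and limit operators -/

/-- The `C⋆`-algebra `BUC(ℂⁿ)` of bounded uniformly continuous functions. -/
def BUC (n : ℕ) : StarSubalgebra ℂ (Cn n →ᵇ ℂ) where
  carrier := {f | UniformContinuous f}
  add_mem' := fun {f g} hf hg => by
    show UniformContinuous fun x => f x + g x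
    exact UniformContinuous.add hf hg
  mul_mem' := fun {f g} hf hg => by
    rw [Set.mem_ofPred_eq, Metric.uniformContinuous_iff] at *
    intro ε hε
    set M : ℝ := ‖f‖ + ‖g‖ + 1 with hM
    have hM0 : 0 < M := by positivity
    obtain ⟨a, ha, hfa⟩ := hf (ε / (2 * M)) (by positivity)
    obtain ⟨b, hb, hgb⟩ := hg (ε / (2 * M)) (by positivity)
    refine ⟨min a b, lt_min ha hb, fun {x y} hxy => ?_⟩
    have h1 := hfa (hxy.trans_le (min_le_left _ _))
    have h2 := hgb (hxy.trans_le (min_le_right _ _))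
    rw [dist_eq_norm] at h1 h2 ⊢
    have e : (f * g) x - (f * g) y = (f x - f y) * g x + f y * (g x - g y) := by
      simp only [BoundedContinuousFunction.mul_apply]; ring
    have h3 : ‖g x‖ ≤ M := (g.norm_coe_le_norm x).trans (by rw [hM]; linarith [norm_nonneg f])
    have h4 : ‖f y‖ ≤ M := (f.norm_coe_le_norm y).trans (by rw [hM]; linarith [norm_nonneg g])
    calc ‖(f * g) x - (f * g) y‖ ≤ ‖f x - f y‖ * ‖g x‖ + ‖f y‖ * ‖g x - g y‖ := by
          rw [e]; exact (norm_add_le _ _).trans (by simp only [norm_mul]; exact le_rfl)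
      _ ≤ ‖f x - f y‖ * M + M * ‖g x - g y‖ := by gcongr
      _ < ε / (2 * M) * M + M * (ε / (2 * M)) := by gcongr
      _ = ε := by field_simp; ring
  algebraMap_mem' := fun c => by
    show UniformContinuous fun _ : Cn n => c
    exact uniformContinuous_const
  star_mem' := fun {f} hf => by
    show UniformContinuous fun x => star (f x)
    exact (starₗᵢ ℂ : ℂ ≃ₗᵢ⋆[ℂ] ℂ).isometry.uniformContinuous.comp hf

/-- The maximal ideal space of `BUC(ℂⁿ)`, with its weak-⋆ topology. -/
abbrev MaxIdealSpace (n : ℕ) : Type := WeakDual.characterSpace ℂ (BUC n)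

/-- A point `z` of `ℂⁿ`, seen in the maximal ideal space as the evaluation `f ↦ f(z)`. -/
def evalAt {n : ℕ} (z : Cn n) : MaxIdealSpace n :=
  ⟨StrongDual.toWeakDual (LinearMap.mkContinuous
      { toFun := fun f : BUC n => (f : Cn n →ᵇ ℂ) z
        map_add' := fun _ _ => rfl
        map_smul' := fun _ _ => rfl } 1
      (fun f => by simpa using (f : Cn n →ᵇ ℂ).norm_coe_le_norm z)), by
    constructor
    · intro h
      have := congrArg (fun φ : WeakDual ℂ (BUC n) => φ 1) h
      exact one_ne_zero this
    · intro f g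
      rfl⟩

/-- The boundary `∂ℂⁿ`: the points of the maximal ideal space outside `ℂⁿ`. -/
def boundary (n : ℕ) : Set (MaxIdealSpace n) := (Set.range evalAt)ᶜ

/-- `Ψ` extends `z ↦ α_z(A)` from `ℂⁿ` to the maximal ideal space, continuously for the strong
operator topology. -/
structure IsStrongExtension {n : ℕ} {t : ℝ} [Fact (0 < t)] {κ : Kind} (A : Op n t κ)
    (Ψ : MaxIdealSpace n → Op n t κ) : Prop where
  extends_shift : ∀ z, Ψ (evalAt z) = shift z A
  continuous : ∀ f, Continuous fun x => Ψ x f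

/-- The pairing `⟨f, g⟩ = ∫ f ḡ dμ_t`. -/
def pairing {n : ℕ} (t : ℝ) (f g : Cn n → ℂ) : ℂ := ∫ w, f w * conj (g w) ∂(gaussian n t)

/-- `B = B₀**`: under the dualities `(f_t^∞)' ≅ F_t^1` and `(F_t^1)' ≅ F_t^∞` given by the pairing,
some `C` on `F_t^1` is the adjoint of `B₀` on `f_t^∞`, and `B` on `F_t^∞` is the adjoint of `C`. -/
def IsBiadjoint {n : ℕ} {t : ℝ} [Fact (0 < t)] (B₀ : Op n t .vanish) (B : Op n t .infty) : Prop :=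
  ∃ C : Op n t (.pow 1 le_rfl),
    (∀ (f : FockSpace n t .vanish) (g : FockSpace n t (.pow 1 le_rfl)),
      pairing t (B₀ f) g = pairing t f (C g)) ∧
    (∀ (f : FockSpace n t .infty) (g : FockSpace n t (.pow 1 le_rfl)),
      pairing t (B f) g = pairing t f (C g))

/-- `A` on `F_t^∞` leaves `f_t^∞` invariant and restricts to `A₀` there. -/
def RestrictsTo {n : ℕ} {t : ℝ} [Fact (0 < t)] (A : Op n t .infty) (A₀ : Op n t .vanish) : Prop :=
  ∀ (f : FockSpace n t .infty) (f₀ : FockSpace n t .vanish), (∀ z, f z = f₀ z) →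
    ∀ z, A f z = A₀ f₀ z

/-- `Ψ x = α_x(A)` for all `x` in the maximal ideal space: by strongly continuous extension on all
Fock spaces but `F_t^∞`, where `α_x(A) = (α_x(A|_{f_t^∞}))**`. The values at the boundary points
are the limit operators of `A`. -/
def IsLimitFamily {n : ℕ} {t : ℝ} [Fact (0 < t)] : {κ : Kind} → (A : Op n t κ) →
    (Ψ : MaxIdealSpace n → Op n t κ) → Prop
  | .pow _ _, A, Ψ => IsStrongExtension A Ψ
  | .vanish, A, Ψ => IsStrongExtension A Ψ
  | .infty, A, Ψ => ∃ (A₀ : Op n t .vanish) (Ψ₀ : MaxIdealSpace n → Op n t .vanish),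
      RestrictsTo A A₀ ∧ IsStrongExtension A₀ Ψ₀ ∧ ∀ x, IsBiadjoint (Ψ₀ x) (Ψ x)

end Fock

end

/-!
The limit operators of `A_k` are integral operators again, and their kernels are found pointwise.
Conjugation by the Weyl operator `W_x` turns `A_k` into the operator with kernel
`shiftKernel t x k`, which is holomorphic, anti-holomorphic and dominated by the same functions
`H` as `k`. A domination by an integrable function improves, by the sub-mean value property, to a
uniform bound on the weighted kernel (`Dominates.isBoundedKernel`); Cauchy estimates then make all
the shifted kernels equicontinuous on bounded sets. Since the shifts act on each other
(`shiftKernel_shiftKernel`), equicontinuity at the identity shows that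
`x ↦ shiftKernel t x k w z` belongs to `BUC(ℂⁿ)` for all `w` and `z`. Applying a character `x` of
`BUC(ℂⁿ)` to this function defines `limitKernel`. Point evaluations are dense in the maximal ideal
space (`denseRange_evalAt`), so each limit kernel is a pointwise limit of shifted kernels along an
ultrafilter. Domination passes to the limit trivially, and holomorphy passes to it because
pointwise limits of locally bounded families of entire functions are entire
(`differentiable_of_tendsto`).

Every kernel in `𝒲_t` defines a bounded operator on every Fock space, by Young's inequality
(`eLpNorm_conv_le`). The maximal ideal space is not metrizable, so strong continuity of
`x ↦ A_{k_x}` cannot be had from dominated convergence along sequences. Instead the integral is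
split into a tail of the function, a part far from the diagonal, both small uniformly in `x` by
Young's inequality, and a part on a bounded set, where `k_x` depends on `x` uniformly because it is
jointly continuous (`tendsto_integralOp`). Density of `ℂⁿ` makes the strong extension unique.

On `F_t^∞` the operator with kernel `k_x` is the biadjoint of the one on `f_t^∞`, the operator in
between having the kernel `conj (k_x(z, w))` on `F_t^1` (`isBiadjoint_integralOp`). Biadjoints are
unique because the pairing with the normalized reproducing kernel at `z` recovers the value at `z`
(`pairing_normKernel`). Finally, if two kernels represent `A`, uniqueness of the limit family shows
that both families of limit kernels represent the same limit operators.
-/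

noncomputable section

namespace Fock

open scoped ENNReal

/-! ### Entire functions of several variables -/

section entire

variable {E : Type*} [NormedAddCommGroup E] [NormedSpace ℂ E]

/-- Lipschitz estimate with a constant that depends only on a local bound, from the Schwarz
lemma. -/
theorem dist_le_of_entire_of_bound {f : E → ℂ} (hf : Differentiable ℂ f) {c : E} {M : ℝ}
    (hM : ∀ w ∈ Metric.ball c 2, ‖f w‖ ≤ M) {a b : E} (ha : a ∈ Metric.ball c 1)
    (hb : b ∈ Metric.ball a 1) : ‖f b - f a‖ ≤ 2 * M * ‖b - a‖ := by
  have hsub : ∀ w ∈ Metric.ball a 1, w ∈ Metric.ball c 2 := fun w hw => by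
    rw [Metric.mem_ball] at *
    linarith [dist_triangle w a c]
  have h := Complex.dist_le_div_mul_dist_of_mapsTo_ball (f := f) (c := a) (z := b) (R₁ := 1)
    (R₂ := 2 * M) hf.differentiableOn (fun w hw => ?_) hb
  · simpa [dist_eq_norm] using h
  · rw [Metric.mem_closedBall, dist_eq_norm]
    have h1 := hM w (hsub w hw)
    have h2 := hM a (hsub a (Metric.mem_ball_self one_pos))
    linarith [norm_sub_le (f w) (f a)]

theorem norm_fderiv_le_of_entire_of_bound {f : E → ℂ} (hf : Differentiable ℂ f) {c : E} {M : ℝ}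
    (hM : ∀ w ∈ Metric.ball c 1, ‖f w‖ ≤ M) : ‖fderiv ℂ f c‖ ≤ 2 * M := by
  have h := Complex.norm_fderiv_le_div_of_mapsTo_ball (f := f) (c := c) (R₁ := 1)
    (R₂ := 2 * M) hf.differentiableOn (fun w hw => ?_) one_pos
  · simpa using h
  · rw [Metric.mem_closedBall, dist_eq_norm]
    have h1 := hM w hw
    have h2 := hM c (Metric.mem_ball_self one_pos)
    linarith [norm_sub_le (f w) (f c)]

/-- Second-order Taylor estimate with a constant that depends only on a local bound. -/
theorem taylor_bound_of_entire {f : E → ℂ} (hf : Differentiable ℂ f) {c : E} {M : ℝ}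
    (hM : ∀ w ∈ Metric.ball c 1, ‖f w‖ ≤ M) {z : E} (hz : z ∈ Metric.ball c 1) :
    ‖f z - f c - fderiv ℂ f c (z - c)‖ ≤ 4 * M * ‖z - c‖ ^ 2 := by
  have hD := norm_fderiv_le_of_entire_of_bound hf hM
  -- Subtracting the linear part gives a function to which the second-order Schwarz lemma applies.
  set g : E → ℂ := fun w => f w - fderiv ℂ f c (w - c) with hg
  have hgd : Differentiable ℂ g :=
    hf.sub ((fderiv ℂ f c).differentiable.comp (differentiable_id.sub_const c))
  have hgc : g c = f c := by simp [hg]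
  have h := Complex.dist_le_mul_div_pow_of_mapsTo_ball_of_isLittleO (f := g) (c := c) (z := z)
    (R₁ := 1) (R₂ := 4 * M) (n := 1) hgd.differentiableOn (fun w hw => ?_) ?_ hz
  · rw [dist_eq_norm, dist_eq_norm, hgc] at h
    have e : f z - f c - fderiv ℂ f c (z - c) = g z - f c := by simp only [hg]; ring
    rw [e]
    simpa using h
  · rw [Metric.mem_closedBall, dist_eq_norm, hgc]
    have h1 := hM w hw
    have h2 := hM c (Metric.mem_ball_self one_pos)
    have h3 : ‖fderiv ℂ f c (w - c)‖ ≤ 2 * M := by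
      refine ((fderiv ℂ f c).le_opNorm _).trans ?_
      rw [Metric.mem_ball, dist_eq_norm] at hw
      nlinarith [norm_nonneg (fderiv ℂ f c), norm_nonneg (w - c)]
    have e : g w - f c = f w - f c - fderiv ℂ f c (w - c) := by simp only [hg]; ring
    rw [e]
    linarith [norm_sub_le (f w - f c) (fderiv ℂ f c (w - c)), norm_sub_le (f w) (f c)]
  · have := (hf c).hasFDerivAt.isLittleO
    refine (this.norm_right.congr_left fun w => ?_).congr_right fun w => (pow_one _).symm
    simp only [hg, sub_self, map_zero]
    ring

/-- A pointwise limit of entire functions that are uniformly bounded near every point is entire: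
the derivatives at a point stay in a compact set, and the second-order Taylor estimates pass to
the limit. -/
theorem differentiable_of_tendsto [FiniteDimensional ℂ E] {ι : Type*} (U : Ultrafilter ι)
    {F : ι → E → ℂ} {G : E → ℂ} (hF : ∀ i, Differentiable ℂ (F i))
    (hb : ∀ c, ∃ M, ∀ i, ∀ w ∈ Metric.ball c 1, ‖F i w‖ ≤ M)
    (hlim : ∀ z, Tendsto (fun i => F i z) U (𝓝 (G z))) : Differentiable ℂ G := by
  intro c
  obtain ⟨M, hM⟩ := hb c
  have hcomp : IsCompact (Metric.closedBall (0 : E →L[ℂ] ℂ) (2 * M)) := isCompact_closedBall _ _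
  obtain ⟨D, -, hD⟩ := hcomp.ultrafilter_le_nhds (U.map fun i => fderiv ℂ (F i) c) (by
    rw [Ultrafilter.coe_map, le_principal_iff, mem_map]
    refine Eventually.of_forall fun i => ?_
    simpa using norm_fderiv_le_of_entire_of_bound (hF i) (hM i))
  have hD' : Tendsto (fun i => fderiv ℂ (F i) c) U (𝓝 D) := hD
  have key : ∀ z ∈ Metric.ball c 1, ‖G z - G c - D (z - c)‖ ≤ 4 * M * ‖z - c‖ ^ 2 := by
    intro z hz
    have h1 : Tendsto (fun i => ‖F i z - F i c - fderiv ℂ (F i) c (z - c)‖) U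
        (𝓝 ‖G z - G c - D (z - c)‖) :=
      (((hlim z).sub (hlim c)).sub
        (((ContinuousLinearMap.apply ℂ ℂ (z - c)).continuous.tendsto D).comp hD')).norm
    exact le_of_tendsto h1 (Eventually.of_forall fun i => taylor_bound_of_entire (hF i) (hM i) hz)
  have : HasFDerivAt G D c := by
    rw [hasFDerivAt_iff_isLittleO]
    have h2 : (fun z => G z - G c - D (z - c)) =O[𝓝 c] fun z => ‖z - c‖ ^ 2 := by
      refine Asymptotics.IsBigO.of_bound (4 * M) ?_
      filter_upwards [Metric.ball_mem_nhds c one_pos] with z hz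
      simpa using key z hz
    refine h2.trans_isLittleO ?_
    rw [Asymptotics.isLittleO_iff]
    intro ε hε
    filter_upwards [Metric.ball_mem_nhds c hε] with z hz
    rw [Metric.mem_ball, dist_eq_norm] at hz
    rw [Real.norm_of_nonneg (by positivity), pow_two]
    exact mul_le_mul_of_nonneg_right hz.le (norm_nonneg _)
  exact this.differentiableAt

end entire

variable {n : ℕ} {t : ℝ}

/-- Multiplication by a unimodular number is a real-linear isometry of `ℂⁿ`. -/
def rotation (n : ℕ) (a : ℂ) (ha : ‖a‖ = 1) : Cn n ≃ₗᵢ[ℝ] Cn n where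
  toFun w := a • w
  invFun w := a⁻¹ • w
  map_add' := smul_add a
  map_smul' r w := smul_comm a r w
  left_inv w := inv_smul_smul₀ (norm_ne_zero_iff.1 (by simp [ha])) w
  right_inv w := smul_inv_smul₀ (norm_ne_zero_iff.1 (by simp [ha])) w
  norm_map' w := by
    show ‖a • w‖ = ‖w‖
    rw [norm_smul, ha, one_mul]

theorem measurePreserving_unit_smul (a : ℂ) (ha : ‖a‖ = 1) :
    MeasurePreserving (fun w : Cn n => a • w) :=
  (rotation n a ha).measurePreserving

/-- Mean value property: an entire function has mean `g(0)` with respect to every finite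
rotation-invariant measure. Averaging over the rotations `w ↦ e^{iθ} w` reduces this to the mean
value property on circles. -/
theorem integral_eq_of_rotation_invariant {ν : Measure (Cn n)} [IsFiniteMeasure ν]
    (hν : ∀ a : ℂ, ‖a‖ = 1 → MeasurePreserving (fun w : Cn n => a • w) ν ν)
    {g : Cn n → ℂ} (hg : Differentiable ℂ g) (hi : Integrable g ν) :
    ∫ w, g w ∂ν = ν.real Set.univ • g 0 := by
  have hn : ∀ θ : ℝ, ‖circleMap 0 1 θ‖ = 1 := fun θ => by simp
  have hinv : ∀ a : ℂ, ‖a‖ = 1 → ∫ w, g (a • w) ∂ν = ∫ w, g w ∂ν := fun a ha => by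
    have hm := hν a ha
    have := hm.integral_comp (rotation n a ha).toHomeomorph.measurableEmbedding g
    exact this
  have hcont : Continuous fun p : ℝ × Cn n => g (circleMap 0 1 p.1 • p.2) := by
    have := hg.continuous
    have h2 := continuous_circleMap 0 1
    fun_prop
  set μ : Measure ℝ := volume.restrict (Set.uIoc 0 (2 * Real.pi)) with hμ
  have : IsFiniteMeasure μ := ⟨by simp [hμ, Set.uIoc]⟩
  have hprod : Integrable (fun p : ℝ × Cn n => g (circleMap 0 1 p.1 • p.2)) (μ.prod ν) := by
    rw [integrable_prod_iff hcont.aestronglyMeasurable]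
    constructor
    · refine Eventually.of_forall fun θ => ?_
      exact (hν _ (hn θ)).integrable_comp_of_integrable hi
    · have : (fun θ : ℝ => ∫ w, ‖g (circleMap 0 1 θ • w)‖ ∂ν) = fun _ => ∫ w, ‖g w‖ ∂ν := by
        funext θ
        exact (hν _ (hn θ)).integral_comp
          (rotation n _ (hn θ)).toHomeomorph.measurableEmbedding (fun w => ‖g w‖)
      rw [this]
      exact integrable_const _
  have hswap := integral_integral_swap (f := fun θ w => g (circleMap 0 1 θ • w)) (μ := μ) (ν := ν)
    hprod
  -- One side of Fubini's theorem uses the invariance of `ν`, the other the mean value property on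
  -- the circle through `w`.
  have hl : ∫ θ, ∫ w, g (circleMap 0 1 θ • w) ∂ν ∂μ = ((2 * Real.pi : ℝ) : ℂ) * ∫ w, g w ∂ν := by
    simp only [hinv _ (hn _), integral_const, hμ]
    have := Real.pi_pos
    rw [Measure.real, Measure.restrict_apply_univ, Set.uIoc_of_le (by positivity),
      Real.volume_Ioc, sub_zero, ENNReal.toReal_ofReal (by positivity)]
    simp
  have hr : ∀ w, ∫ θ, g (circleMap 0 1 θ • w) ∂μ = ((2 * Real.pi : ℝ) : ℂ) * g 0 := by
    intro w
    have hd : Differentiable ℂ fun s : ℂ => g (s • w) :=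
      hg.comp (differentiable_id.smul_const w)
    have h := DiffContOnCl.circleAverage (f := fun s : ℂ => g (s • w)) (c := 0) (R := 1)
      hd.diffContOnCl
    have hpi := Real.pi_pos
    rw [Real.circleAverage, intervalIntegral.integral_of_le (by positivity)] at h
    rw [hμ, Set.uIoc_of_le (by positivity)]
    simp only [zero_smul] at h
    rw [← h]
    have hne : (Real.pi : ℂ) ≠ 0 := by exact_mod_cast hpi.ne'
    simp
    field_simp
  rw [hl] at hswap
  simp only [hr, integral_const] at hswap
  have hne : ((2 * Real.pi : ℝ) : ℂ) ≠ 0 := by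
    exact_mod_cast (by have := Real.pi_pos; positivity : 2 * Real.pi ≠ 0)
  refine mul_left_cancel₀ hne ?_
  rw [hswap]
  simp
  ring

/-! ### The Gaussian measure and the sub-mean value property -/

theorem integral_gaussian (ht : 0 < t) (F : Cn n → ℂ) :
    ∫ w, F w ∂(gaussian n t) =
      ∫ w, ((((Real.pi * t) ^ n)⁻¹ * Real.exp (-‖w‖ ^ 2 / t) : ℝ) : ℂ) * F w := by
  have hpi := Real.pi_pos
  have hc : Continuous fun z : Cn n => ((Real.pi * t) ^ n)⁻¹ * Real.exp (-‖z‖ ^ 2 / t) := by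
    fun_prop
  rw [gaussian, integral_withDensity_eq_integral_toReal_smul hc.measurable.ennreal_ofReal
    (Eventually.of_forall fun _ => ENNReal.ofReal_lt_top)]
  refine integral_congr_ae (Eventually.of_forall fun w => ?_)
  simp only
  rw [ENNReal.toReal_ofReal (by positivity), Complex.real_smul]

theorem integrable_gaussian_iff (ht : 0 < t) (F : Cn n → ℂ) :
    Integrable F (gaussian n t) ↔
      Integrable fun w => (((((Real.pi * t) ^ n)⁻¹ * Real.exp (-‖w‖ ^ 2 / t) : ℝ)) : ℂ) * F w := by
  have hpi := Real.pi_pos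
  have hc : Continuous fun z : Cn n => ((Real.pi * t) ^ n)⁻¹ * Real.exp (-‖z‖ ^ 2 / t) := by
    fun_prop
  rw [gaussian, integrable_withDensity_iff_integrable_smul' hc.measurable.ennreal_ofReal
    (Eventually.of_forall fun _ => ENNReal.ofReal_lt_top)]
  refine integrable_congr (Eventually.of_forall fun w => ?_)
  simp only
  rw [ENNReal.toReal_ofReal (by positivity), Complex.real_smul]

theorem integrable_exp_neg_norm_sq {b : ℝ} (hb : 0 < b) :
    Integrable fun w : Cn n => Real.exp (-b * ‖w‖ ^ 2) := by
  have h := GaussianFourier.integrable_cexp_neg_mul_sq_norm_add (V := Cn n) (b := (b : ℂ))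
    (by simpa using hb) 0 0
  refine h.norm.congr (Eventually.of_forall fun w => ?_)
  simp only [Complex.norm_exp]
  norm_cast
  simp

instance (n : ℕ) (t : ℝ) [ht : Fact (0 < t)] : IsFiniteMeasure (gaussian n t) := by
  have hpi := Real.pi_pos
  have ht' := ht.out
  refine isFiniteMeasure_withDensity_ofReal ?_
  have h := (integrable_exp_neg_norm_sq (n := n) (b := 1 / t) (by positivity)).const_mul
    ((Real.pi * t) ^ n)⁻¹
  refine (h.congr (Eventually.of_forall fun w => ?_)).2
  simp only
  congr 2
  ring

theorem gaussian_real_univ_ne_zero (n : ℕ) (t : ℝ) [ht : Fact (0 < t)] :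
    (gaussian n t).real Set.univ ≠ 0 := by
  have hpi := Real.pi_pos
  have ht' := ht.out
  rw [Measure.real, ENNReal.toReal_ne_zero]
  refine ⟨fun h => ?_, measure_ne_top _ _⟩
  rw [Measure.measure_univ_eq_zero, gaussian, withDensity_eq_zero_iff] at h
  · obtain ⟨w, hw⟩ := h.exists
    simp only [Pi.zero_apply, ENNReal.ofReal_eq_zero] at hw
    exact absurd hw (not_le.2 (by positivity))
  · have hc : Continuous fun z : Cn n => ((Real.pi * t) ^ n)⁻¹ * Real.exp (-‖z‖ ^ 2 / t) := by
      fun_prop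
    exact hc.measurable.ennreal_ofReal.aemeasurable

theorem measurePreserving_gaussian (n : ℕ) (t : ℝ) {a : ℂ} (ha : ‖a‖ = 1) :
    MeasurePreserving (fun w : Cn n => a • w) (gaussian n t) (gaussian n t) := by
  have hm := measurePreserving_unit_smul (n := n) a ha
  refine ⟨hm.measurable, ?_⟩
  ext s hs
  rw [Measure.map_apply hm.measurable hs, gaussian, withDensity_apply _ (hm.measurable hs),
    withDensity_apply _ hs, ← hm.setLIntegral_comp_preimage hs (by fun_prop)]
  simp [norm_smul, ha]

theorem weylFun_neg_apply_zero (z : Cn n) (f : Cn n → ℂ) :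
    weylFun t (-z) f 0 = Complex.exp (-((‖z‖ ^ 2 / (2 * t) : ℝ) : ℂ)) * f z := by
  simp [weylFun, normKernel]

/-- The constant of the sub-mean value property `norm_weighted_le`: the mean is taken over a unit
ball, on which the weight is at least `exp(-1 / (2t))`. -/
def meanConst (n : ℕ) (t : ℝ) : ℝ :=
  (volume.real (Metric.ball (0 : Cn n) 1))⁻¹ * Real.exp (1 / (2 * t))

theorem meanConst_nonneg (n : ℕ) (t : ℝ) : 0 ≤ meanConst n t :=
  mul_nonneg (inv_nonneg.2 measureReal_nonneg) (Real.exp_nonneg _)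

/-- Sub-mean value property of the weighted functions; translating the centre of the ball to the
origin by a Weyl operator makes the constant independent of the centre. -/
theorem norm_weighted_le (ht : 0 < t) {f : Cn n → ℂ} (hf : Differentiable ℂ f) (z : Cn n) :
    ‖weighted t f z‖ ≤ meanConst n t * ∫ w in Metric.ball (0 : Cn n) 1, ‖weighted t f (z + w)‖ := by
  set g := weylFun t (-z) f with hg
  have hgd : Differentiable ℂ g := differentiable_weylFun (-z) hf
  have hgn : ∀ w, ‖weighted t g w‖ = ‖weighted t f (z + w)‖ := fun w => by
    rw [hg, norm_weighted_weylFun ht, sub_neg_eq_add, add_comm]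
  have hg0 : ‖g 0‖ = ‖weighted t f z‖ := by
    have := hgn 0
    rw [add_zero] at this
    rw [← this, norm_weighted]
    simp
  set B := Metric.ball (0 : Cn n) 1 with hB
  have hgi : IntegrableOn g B := by
    exact (hgd.continuous.continuousOn.integrableOn_compact
      (isCompact_closedBall (0 : Cn n) 1)).mono_set Metric.ball_subset_closedBall
  have hrot : ∀ a : ℂ, ‖a‖ = 1 →
      MeasurePreserving (fun w : Cn n => a • w) (volume.restrict B) (volume.restrict B) := by
    intro a ha
    have h := (measurePreserving_unit_smul (n := n) a ha).restrict_preimage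
      (s := B) measurableSet_ball
    have e : (fun w : Cn n => a • w) ⁻¹' B = B := by
      ext w; simp [hB, norm_smul, ha]
    rwa [e] at h
  have hfin : volume B < ⊤ := measure_ball_lt_top
  have : IsFiniteMeasure (volume.restrict B) := ⟨by simpa using hfin⟩
  have hmean := integral_eq_of_rotation_invariant hrot hgd hgi
  have hpos : 0 < volume.real B :=
    ENNReal.toReal_pos (Metric.measure_ball_pos volume 0 one_pos).ne' hfin.ne
  have hu : (volume.restrict B).real Set.univ = volume.real B := by simp [Measure.real]
  rw [hu] at hmean
  have h1 : volume.real B * ‖g 0‖ ≤ ∫ w in B, ‖g w‖ := by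
    have := norm_integral_le_integral_norm (μ := volume.restrict B) g
    rwa [hmean, norm_smul, Real.norm_of_nonneg hpos.le] at this
  have h2 : ∫ w in B, ‖g w‖ ≤ ∫ w in B, Real.exp (1 / (2 * t)) * ‖weighted t f (z + w)‖ := by
    refine setIntegral_mono_on hgi.norm ?_ measurableSet_ball fun w hw => ?_
    · have hc : Continuous fun w => Real.exp (1 / (2 * t)) * ‖weighted t f (z + w)‖ :=
        continuous_const.mul (((continuous_weighted hf).comp (continuous_const_add z)).norm)
      exact (hc.continuousOn.integrableOn_compact
        (isCompact_closedBall (0 : Cn n) 1)).mono_set Metric.ball_subset_closedBall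
    · rw [← hgn, norm_weighted, mul_left_comm, ← Real.exp_add]
      refine le_mul_of_one_le_right (norm_nonneg _) (Real.one_le_exp ?_)
      have : ‖w‖ ^ 2 ≤ 1 := by
        rw [hB, mem_ball_zero_iff] at hw
        nlinarith [norm_nonneg w]
      rw [← add_div]
      exact div_nonneg (by linarith) (by positivity)
  rw [integral_const_mul] at h2
  rw [← hg0, meanConst, mul_assoc, inv_mul_eq_div, le_div_iff₀ hpos, mul_comm]
  exact h1.trans h2

/-- The translation behaviour of the Gaussian density, in terms of the reproducing kernel. -/
theorem exp_mul_normKernel_neg (ht : 0 < t) (z u : Cn n) :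
    (Real.exp (-‖u‖ ^ 2 / t) : ℂ) * normKernel t (-z) u =
      (Real.exp (-‖u + z‖ ^ 2 / t) : ℂ) * conj (normKernel t z (u + z)) := by
  simp only [normKernel, ← Complex.exp_conj]
  push_cast
  rw [← Complex.exp_add, ← Complex.exp_add]
  congr 1
  have h1 : ((‖u + z‖ : ℝ) : ℂ) ^ 2 =
      ((‖u‖ : ℝ) : ℂ) ^ 2 + inner ℂ u z + inner ℂ z u + ((‖z‖ : ℝ) : ℂ) ^ 2 := by
    have e := fun x : Cn n => inner_self_eq_norm_sq_to_K (𝕜 := ℂ) x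
    simp only [Complex.coe_algebraMap] at e
    rw [← e, ← e, ← e, inner_add_left, inner_add_right, inner_add_right]
    ring
  simp only [map_sub, map_add, map_div₀, Complex.conj_ofReal, inner_conj_symm, inner_add_right,
    inner_neg_left, map_mul, map_pow, map_ofNat, norm_neg, h1]
  have h2 : (inner ℂ z z : ℂ) = ((‖z‖ : ℝ) : ℂ) ^ 2 := by
    simp
  have hne : (t : ℂ) ≠ 0 := by exact_mod_cast ht.ne'
  simp only [h2]
  field_simp
  ring

/-- Recovery of `f(z)` from the pairing of `f` with the normalized reproducing kernel. -/
theorem pairing_normKernel [ht : Fact (0 < t)] {f : Cn n → ℂ} (hf : Differentiable ℂ f) {M : ℝ}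
    (hM : ∀ w, ‖weighted t f w‖ ≤ M) (z : Cn n) :
    pairing t f (normKernel t z) =
      ((gaussian n t).real Set.univ : ℂ) *
        (Complex.exp (-((‖z‖ ^ 2 / (2 * t) : ℝ) : ℂ)) * f z) := by
  have hpi := Real.pi_pos
  have ht' := ht.out
  set g := weylFun t (-z) f with hg
  have hgd : Differentiable ℂ g := differentiable_weylFun (-z) hf
  have hgi : Integrable g (gaussian n t) := by
    rw [integrable_gaussian_iff ht.out]
    have h := (integrable_exp_neg_norm_sq (n := n) (b := 1 / (2 * t)) (by positivity)).const_mul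
      (((Real.pi * t) ^ n)⁻¹ * M)
    refine h.mono' ?_ (Eventually.of_forall fun w => ?_)
    · have := hgd.continuous
      exact Continuous.aestronglyMeasurable (by fun_prop)
    · have h1 : ‖weighted t g w‖ ≤ M := by
        rw [hg, norm_weighted_weylFun ht.out]; exact hM _
      rw [norm_weighted] at h1
      rw [norm_mul, Complex.norm_real, Real.norm_of_nonneg (by positivity)]
      have e : Real.exp (-‖w‖ ^ 2 / t) =
          Real.exp (-‖w‖ ^ 2 / (2 * t)) * Real.exp (-(1 / (2 * t)) * ‖w‖ ^ 2) := by
        rw [← Real.exp_add]; congr 1; field_simp; ring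
      rw [e]
      calc _ = ((Real.pi * t) ^ n)⁻¹ * (‖g w‖ * Real.exp (-‖w‖ ^ 2 / (2 * t))) *
            Real.exp (-(1 / (2 * t)) * ‖w‖ ^ 2) := by ring
        _ ≤ _ := by gcongr
  have hmean := integral_eq_of_rotation_invariant
    (fun a ha => measurePreserving_gaussian n t ha) hgd hgi
  rw [hg, weylFun_neg_apply_zero, ← hg, Complex.real_smul] at hmean
  rw [← hmean, pairing, integral_gaussian ht.out, integral_gaussian ht.out,
    ← integral_add_right_eq_self _ z]
  refine integral_congr_ae (Eventually.of_forall fun u => ?_)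
  simp only [hg, weylFun, sub_neg_eq_add]
  have h := exp_mul_normKernel_neg ht' z u
  push_cast at h ⊢
  linear_combination ((Real.pi * t : ℂ) ^ n)⁻¹ * f (u + z) * -h

variable {M : ℝ} {k : Cn n → Cn n → ℂ}

/-! ### Kernels and their shifts -/

/-- The weighted kernel `k(w, z) exp(-(|z|² + |w|²) / (2t))`. -/
def weightedKernel (t : ℝ) (k : Cn n → Cn n → ℂ) (w z : Cn n) : ℂ :=
  k w z * (Real.exp (-(‖z‖ ^ 2 + ‖w‖ ^ 2) / (2 * t)) : ℝ)

theorem norm_weightedKernel (w z : Cn n) : ‖weightedKernel t k w z‖ =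
    ‖k w z‖ * Real.exp (-(‖z‖ ^ 2 + ‖w‖ ^ 2) / (2 * t)) := by
  rw [weightedKernel, norm_mul, Complex.norm_real, Real.norm_of_nonneg (Real.exp_nonneg _)]

theorem norm_weightedKernel_le_iff {C : ℝ} (w z : Cn n) : ‖weightedKernel t k w z‖ ≤ C ↔
    ‖k w z‖ ≤ Real.exp ((‖z‖ ^ 2 + ‖w‖ ^ 2) / (2 * t)) * C := by
  rw [norm_weightedKernel, neg_div, Real.exp_neg, ← div_eq_mul_inv, div_le_iff₀ (Real.exp_pos _),
    mul_comm C]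

/-- Kernels that are holomorphic in `z`, anti-holomorphic in `w`, and bounded after weighting. -/
structure IsBoundedKernel (t M : ℝ) (k : Cn n → Cn n → ℂ) : Prop where
  holomorphic : ∀ w, Differentiable ℂ fun z => k w z
  antiholomorphic : ∀ z, Differentiable ℂ fun w => conj (k w z)
  bound : ∀ w z, ‖weightedKernel t k w z‖ ≤ M

theorem Dominates.norm_weightedKernel_le {H : Cn n → ℝ} (h : Dominates t H k) (w z : Cn n) :
    ‖weightedKernel t k w z‖ ≤ H (w - z) :=
  (norm_weightedKernel_le_iff w z).2 (h.bound w z)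

theorem weightedKernel_eq_weighted (w z : Cn n) : weightedKernel t k w z =
    (Real.exp (-‖w‖ ^ 2 / (2 * t)) : ℝ) * weighted t (k w) z := by
  rw [weightedKernel, weighted, neg_add, add_div, Real.exp_add]
  push_cast
  ring

/-- A local mean of the dominating function bounds the weighted kernel. -/
theorem Dominates.norm_weightedKernel_le_mean (ht : 0 < t) {H : Cn n → ℝ} (h : Dominates t H k)
    (hk : ∀ w, Differentiable ℂ fun z => k w z) (w z : Cn n) :
    ‖weightedKernel t k w z‖ ≤
      meanConst n t * ∫ u in Metric.ball (0 : Cn n) 1, H (w - (z + u)) := by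
  have h1 := norm_weighted_le ht (hk w) z
  have e : ∀ v, ‖weightedKernel t k w v‖ =
      Real.exp (-‖w‖ ^ 2 / (2 * t)) * ‖weighted t (k w) v‖ := fun v => by
    rw [weightedKernel_eq_weighted, norm_mul, Complex.norm_real,
      Real.norm_of_nonneg (Real.exp_nonneg _)]
  rw [e]
  refine (mul_le_mul_of_nonneg_left h1 (Real.exp_nonneg _)).trans ?_
  rw [mul_left_comm]
  refine mul_le_mul_of_nonneg_left ?_ (meanConst_nonneg n t)
  rw [← integral_const_mul]
  refine integral_mono_of_nonneg (Eventually.of_forall fun u => by positivity) ?_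
    (Eventually.of_forall fun u => ?_)
  · have := (h.integrable.comp_sub_left (w - z)).integrableOn (s := Metric.ball (0 : Cn n) 1)
    simpa only [IntegrableOn, sub_sub] using this
  · simp only
    rw [← e]
    exact h.norm_weightedKernel_le w (z + u)

/-- Although `H` is only integrable, the weighted kernel is bounded. -/
theorem Dominates.isBoundedKernel (ht : 0 < t) {H : Cn n → ℝ} (h : Dominates t H k)
    (hk : IsWienerKernel t k) : IsBoundedKernel t (meanConst n t * ∫ u, H u) k := by
  refine ⟨hk.holomorphic, hk.antiholomorphic, fun w z => ?_⟩
  refine (h.norm_weightedKernel_le_mean ht hk.holomorphic w z).trans ?_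
  refine mul_le_mul_of_nonneg_left ?_ (meanConst_nonneg n t)
  have hi : Integrable fun u => H (w - (z + u)) := by
    simpa only [sub_sub] using h.integrable.comp_sub_left (w - z)
  refine (setIntegral_le_integral hi (Eventually.of_forall fun u => h.nonneg _)).trans_eq ?_
  simp only [← sub_sub]
  exact integral_sub_left_eq_self H volume (w - z)

namespace IsBoundedKernel

/-- The pointwise bound that a weighted bound gives on a ball. -/
theorem norm_le (ht : 0 < t) (hM : 0 ≤ M) (hk : IsBoundedKernel t M k) {R : ℝ} {w z : Cn n}
    (hw : ‖w‖ ≤ R) (hz : ‖z‖ ≤ R) : ‖k w z‖ ≤ Real.exp (R ^ 2 / t) * M := by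
  refine ((norm_weightedKernel_le_iff w z).1 (hk.bound w z)).trans ?_
  refine mul_le_mul_of_nonneg_right (Real.exp_le_exp.2 ?_) hM
  rw [div_le_div_iff₀ (by positivity) ht]
  have h1 := pow_le_pow_left₀ (norm_nonneg _) hw 2
  have h2 := pow_le_pow_left₀ (norm_nonneg _) hz 2
  nlinarith

/-- Kernels with a common weighted bound satisfy a common local Lipschitz estimate. -/
theorem lipschitz (ht : 0 < t) (hM : 0 ≤ M) (hk : IsBoundedKernel t M k) {R : ℝ}
    {w z w' z' : Cn n} (hw : ‖w‖ ≤ R) (hz : ‖z‖ ≤ R) (hw' : ‖w' - w‖ < 1) (hz' : ‖z' - z‖ < 1) :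
    ‖k w' z' - k w z‖ ≤
      2 * (Real.exp ((R + 2) ^ 2 / t) * M) * (‖w' - w‖ + ‖z' - z‖) := by
  have hb : ∀ a : Cn n, ‖a‖ ≤ R → ∀ b ∈ Metric.ball a 2, ‖b‖ ≤ R + 2 := fun a ha b hb => by
    rw [mem_ball_iff_norm] at hb
    have := norm_add_le (b - a) a
    rw [sub_add_cancel] at this
    linarith
  have h1 := dist_le_of_entire_of_bound (hk.antiholomorphic z') (c := w) (a := w) (b := w')
    (M := Real.exp ((R + 2) ^ 2 / t) * M)
    (fun v hv => by
      rw [RCLike.norm_conj]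
      refine hk.norm_le ht hM (hb w hw v hv) (hb z hz z' ?_)
      rw [mem_ball_iff_norm]; linarith)
    (Metric.mem_ball_self one_pos) (by rwa [mem_ball_iff_norm])
  have h2 := dist_le_of_entire_of_bound (hk.holomorphic w) (c := z) (a := z) (b := z')
    (M := Real.exp ((R + 2) ^ 2 / t) * M)
    (fun v hv => hk.norm_le ht hM (by linarith) (hb z hz v hv))
    (Metric.mem_ball_self one_pos) (by rwa [mem_ball_iff_norm])
  rw [← map_sub, RCLike.norm_conj] at h1
  have e : k w' z' - k w z = (k w' z' - k w z') + (k w z' - k w z) := by ring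
  rw [e, mul_add]
  exact (norm_add_le _ _).trans (add_le_add h1 h2)

theorem nonneg (hk : IsBoundedKernel t M k) : 0 ≤ M := (norm_nonneg _).trans (hk.bound 0 0)

theorem continuous (ht : 0 < t) (hk : IsBoundedKernel t M k) :
    Continuous (Function.uncurry k) := by
  rw [continuous_iff_continuousAt]
  rintro ⟨w, z⟩
  rw [ContinuousAt, tendsto_iff_norm_sub_tendsto_zero]
  set C := 2 * (Real.exp ((max ‖w‖ ‖z‖ + 2) ^ 2 / t) * M) with hC
  have hlim : Tendsto (fun p : Cn n × Cn n => C * (‖p.1 - w‖ + ‖p.2 - z‖)) (𝓝 (w, z)) (𝓝 0) := by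
    have : Continuous fun p : Cn n × Cn n => C * (‖p.1 - w‖ + ‖p.2 - z‖) := by fun_prop
    simpa using this.tendsto (w, z)
  refine squeeze_zero' (Eventually.of_forall fun p => norm_nonneg _) ?_ hlim
  have h1 : ∀ᶠ p : Cn n × Cn n in 𝓝 (w, z), p.1 ∈ Metric.ball w 1 :=
    continuous_fst.continuousAt (Metric.ball_mem_nhds w one_pos)
  have h2 : ∀ᶠ p : Cn n × Cn n in 𝓝 (w, z), p.2 ∈ Metric.ball z 1 :=
    continuous_snd.continuousAt (Metric.ball_mem_nhds z one_pos)
  filter_upwards [h1, h2] with p hp1 hp2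
  exact hk.lipschitz ht hk.nonneg (le_max_left _ _) (le_max_right _ _)
    (mem_ball_iff_norm.1 hp1) (mem_ball_iff_norm.1 hp2)

end IsBoundedKernel

/-- The kernel of the shifted operator `α_x(A_k)`. -/
def shiftKernel (t : ℝ) (x : Cn n) (k : Cn n → Cn n → ℂ) (w z : Cn n) : ℂ :=
  normKernel t x z * conj (normKernel t x w) * k (w - x) (z - x)

theorem norm_normKernel (ht : 0 < t) (z w : Cn n) :
    ‖normKernel t z w‖ = Real.exp ((‖w‖ ^ 2 - ‖w - z‖ ^ 2) / (2 * t)) := by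
  have h1 : ‖w - z‖ ^ 2 = ‖w‖ ^ 2 - 2 * (inner ℂ z w : ℂ).re + ‖z‖ ^ 2 := by
    have := @norm_sub_sq ℂ (Cn n) _ _ _ w z
    rw [this, ← inner_re_symm]
    rfl
  rw [normKernel, Complex.norm_exp, h1, Complex.sub_re, Complex.ofReal_re, Complex.div_ofReal_re]
  congr 1
  field_simp
  ring

/-- After weighting, a shift changes a kernel by a translation and a phase only. -/
theorem norm_weightedKernel_shiftKernel (ht : 0 < t) (x w z : Cn n) :
    ‖weightedKernel t (shiftKernel t x k) w z‖ = ‖weightedKernel t k (w - x) (z - x)‖ := by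
  rw [norm_weightedKernel, norm_weightedKernel, shiftKernel, norm_mul, norm_mul, RCLike.norm_conj,
    norm_normKernel ht, norm_normKernel ht, ← Real.exp_add, mul_comm _ ‖k _ _‖, mul_assoc,
    ← Real.exp_add]
  congr 2
  field_simp
  ring

/-- Kernel shifts compose exactly: the phase factors in `W_h W_x` cancel in the conjugation. -/
theorem shiftKernel_shiftKernel (h x : Cn n) :
    shiftKernel t h (shiftKernel t x k) = shiftKernel t (h + x) k := by
  funext w z
  simp only [shiftKernel, sub_sub]
  rw [← mul_assoc]
  congr 1
  simp only [normKernel, ← Complex.exp_conj, ← Complex.exp_add]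
  congr 1
  have e := fun x : Cn n => inner_self_eq_norm_sq_to_K (𝕜 := ℂ) x
  simp only [Complex.coe_algebraMap] at e
  have h1 := e (h + x)
  rw [inner_add_left, inner_add_right, inner_add_right, e, e] at h1
  push_cast
  rw [← h1]
  simp only [map_sub, map_add, map_div₀, map_mul, map_pow, map_ofNat, Complex.conj_ofReal,
    inner_conj_symm, inner_sub_right, inner_add_left]
  ring

theorem differentiable_normKernel (z : Cn n) : Differentiable ℂ (normKernel t z) := by
  have h1 : Differentiable ℂ fun w : Cn n => inner ℂ z w := (innerSL ℂ z).differentiable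
  unfold normKernel
  simp only [div_eq_mul_inv]
  exact ((h1.mul_const _).sub_const _).cexp

theorem continuous_normKernel_left (w : Cn n) : Continuous fun z => normKernel t z w := by
  unfold normKernel
  simp only [div_eq_mul_inv]
  fun_prop

theorem IsBoundedKernel.shiftKernel (ht : 0 < t) (hk : IsBoundedKernel t M k) (x : Cn n) :
    IsBoundedKernel t M (shiftKernel t x k) where
  holomorphic w := by
    have h1 : Differentiable ℂ fun z => k (w - x) (z - x) :=
      (hk.holomorphic (w - x)).comp (differentiable_id.sub_const x)
    exact ((differentiable_normKernel x).mul_const _).mul h1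
  antiholomorphic z := by
    have h1 : Differentiable ℂ fun w => conj (k (w - x) (z - x)) :=
      (hk.antiholomorphic (z - x)).comp (differentiable_id.sub_const x)
    simp only [Fock.shiftKernel, map_mul, Complex.conj_conj]
    exact ((differentiable_normKernel x).const_mul _).mul h1
  bound w z := by
    rw [norm_weightedKernel_shiftKernel ht]
    exact hk.bound _ _

theorem Dominates.shiftKernel (ht : 0 < t) {H : Cn n → ℝ} (h : Dominates t H k) (x : Cn n) :
    Dominates t H (shiftKernel t x k) where
  nonneg := h.nonneg
  integrable := h.integrable
  bound w z := by
    rw [← norm_weightedKernel_le_iff, norm_weightedKernel_shiftKernel ht]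
    simpa using h.norm_weightedKernel_le (w - x) (z - x)

theorem norm_shiftKernel_le (ht : 0 < t) (hk : IsBoundedKernel t M k) (w z x : Cn n) :
    ‖shiftKernel t x k w z‖ ≤ Real.exp ((‖z‖ ^ 2 + ‖w‖ ^ 2) / (2 * t)) * M :=
  (norm_weightedKernel_le_iff w z).1 ((hk.shiftKernel ht x).bound w z)

/-- Small shifts move all kernels with a common weighted bound by a small amount. -/
theorem eventually_norm_shiftKernel_sub_le (ht : 0 < t) (hM : 0 ≤ M) (w z : Cn n) {ε : ℝ}
    (hε : 0 < ε) : ∀ᶠ h in 𝓝 (0 : Cn n), ∀ k : Cn n → Cn n → ℂ, IsBoundedKernel t M k →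
      ‖shiftKernel t h k w z - k w z‖ < ε := by
  set R := max ‖w‖ ‖z‖ with hR
  set B := Real.exp ((R + 1) ^ 2 / t) * M with hB
  set C := 2 * (Real.exp ((R + 2) ^ 2 / t) * M) with hC
  have hlim : Tendsto (fun h => ‖normKernel t h z * conj (normKernel t h w) - 1‖ * B +
      C * (‖h‖ + ‖h‖)) (𝓝 (0 : Cn n)) (𝓝 0) := by
    have h1 := continuous_normKernel_left (t := t) z
    have h2 := continuous_normKernel_left (t := t) w
    have h3 : Continuous fun h => ‖normKernel t h z * conj (normKernel t h w) - 1‖ * B +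
      C * (‖h‖ + ‖h‖) := by fun_prop
    simpa [normKernel] using h3.tendsto 0
  filter_upwards [hlim.eventually_lt_const hε, Metric.ball_mem_nhds (0 : Cn n) one_pos]
    with h hh hh1 k hk
  rw [mem_ball_zero_iff] at hh1
  refine lt_of_le_of_lt ?_ hh
  have e : shiftKernel t h k w z - k w z =
      (normKernel t h z * conj (normKernel t h w) - 1) * k (w - h) (z - h) +
        (k (w - h) (z - h) - k w z) := by
    rw [shiftKernel]; ring
  rw [e]
  refine (norm_add_le _ _).trans (add_le_add ?_ ?_)
  · rw [norm_mul]
    refine mul_le_mul_of_nonneg_left (hk.norm_le ht hM ?_ ?_) (norm_nonneg _)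
    · linarith [norm_sub_le w h, le_max_left ‖w‖ ‖z‖]
    · linarith [norm_sub_le z h, le_max_right ‖w‖ ‖z‖]
  · have := hk.lipschitz ht hM (R := R) (w := w) (z := z) (w' := w - h) (z' := z - h)
      (le_max_left _ _) (le_max_right _ _) (by simpa using hh1) (by simpa using hh1)
    simpa using this

/-- By the composition law of shifts, continuity at the identity that is uniform over all shifted
kernels gives uniform continuity. -/
theorem uniformContinuous_shiftKernel (ht : 0 < t) (hk : IsBoundedKernel t M k) (w z : Cn n) :
    UniformContinuous fun x => shiftKernel t x k w z := by
  rw [Metric.uniformContinuous_iff]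
  intro ε hε
  obtain ⟨δ, hδ, h⟩ := Metric.eventually_nhds_iff.1
    (eventually_norm_shiftKernel_sub_le ht hk.nonneg w z hε)
  refine ⟨δ, hδ, fun {a b} hab => ?_⟩
  have := h (y := a - b) (by simpa [dist_eq_norm] using hab) _ (hk.shiftKernel ht b)
  rwa [shiftKernel_shiftKernel, sub_add_cancel, ← dist_eq_norm] at this

/-- For fixed `w` and `z`, the values at `(w, z)` of all shifts of `k`, as an element of
`BUC(ℂⁿ)`. -/
def shiftBUC (ht : 0 < t) (hk : IsBoundedKernel t M k) (w z : Cn n) : BUC n :=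
  ⟨BoundedContinuousFunction.ofNormedAddCommGroup (fun x => shiftKernel t x k w z)
    (uniformContinuous_shiftKernel ht hk w z).continuous _ (norm_shiftKernel_le ht hk w z),
    uniformContinuous_shiftKernel ht hk w z⟩

/-! ### The maximal ideal space -/

/-- `BUC(ℂⁿ)` is closed under uniform limits, hence complete. -/
instance (n : ℕ) : CompleteSpace (BUC n) := by
  have : IsClosed ((BUC n : StarSubalgebra ℂ (Cn n →ᵇ ℂ)) : Set (Cn n →ᵇ ℂ)) := by
    refine isClosed_of_closure_subset fun f hf => ?_
    rw [Metric.mem_closure_iff] at hf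
    show UniformContinuous f
    rw [Metric.uniformContinuous_iff]
    intro ε hε
    obtain ⟨g, hg, hfg⟩ := hf (ε / 3) (by positivity)
    obtain ⟨δ, hδ, h⟩ := Metric.uniformContinuous_iff.1 (show UniformContinuous g from hg)
      (ε / 3) (by positivity)
    refine ⟨δ, hδ, fun {a b} hab => ?_⟩
    have h1 := (f.dist_coe_le_dist (g := g) a).trans_lt hfg
    have h2 := (f.dist_coe_le_dist (g := g) b).trans_lt hfg
    have h3 := h hab
    rw [dist_comm] at h2
    linarith [dist_triangle4 (f a) (g a) (g b) (f b)]
  exact this.completeSpace_coe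

instance (n : ℕ) : CommCStarAlgebra (BUC n) where

/-- Point evaluations are dense in the maximal ideal space: by the Gelfand transform a continuous
function on it that vanishes on all of them is zero. -/
theorem denseRange_evalAt (n : ℕ) : DenseRange (evalAt (n := n)) := by
  intro x
  by_contra hx
  obtain ⟨F, hF0, hF1, -⟩ := exists_continuous_zero_one_of_isClosed
    (isClosed_closure (s := Set.range (evalAt (n := n)))) (isClosed_singleton (x := x))
    (Set.disjoint_singleton_right.2 hx)
  let G : C(MaxIdealSpace n, ℂ) := ⟨fun y => (F y : ℂ), by fun_prop⟩
  obtain ⟨f, hf⟩ := (gelfandStarTransform (BUC n)).surjective G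
  have hval : ∀ y : MaxIdealSpace n, y f = (F y : ℂ) := fun y => congrArg (fun g => g y) hf
  have hf0 : f = 0 := by
    refine Subtype.ext (BoundedContinuousFunction.ext fun z => ?_)
    have h1 := hval (evalAt z)
    rw [hF0 (subset_closure ⟨z, rfl⟩)] at h1
    exact h1.trans Complex.ofReal_zero
  have h2 := hval x
  rw [hF1 rfl, hf0, map_zero] at h2
  simp at h2

theorem exists_ultrafilter_tendsto (x : MaxIdealSpace n) :
    ∃ U : Ultrafilter (Cn n), ∀ f : BUC n, Tendsto (f : Cn n →ᵇ ℂ) U (𝓝 (x f)) := by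
  -- By density the neighbourhood filter of `x` restricts to a proper filter on `ℂⁿ`.
  have hne : (comap evalAt (𝓝 x)).NeBot := by
    refine comap_neBot fun s hs => ?_
    obtain ⟨_, hy, z, rfl⟩ := mem_closure_iff_nhds.1 (denseRange_evalAt n x) s hs
    exact ⟨z, hy⟩
  refine ⟨Ultrafilter.of (comap evalAt (𝓝 x)), fun f => ?_⟩
  have h1 : Tendsto (fun y : MaxIdealSpace n => y f) (𝓝 x) (𝓝 (x f)) :=
    ((WeakDual.eval_continuous f).comp continuous_subtype_val).tendsto x
  exact (h1.comp tendsto_comap).mono_left (Ultrafilter.of_le _)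

/-! ### Limit kernels -/

/-- The kernel `k_x` of a limit operator: the character `x` applied, for fixed `w` and `z`, to the
function `a ↦ (α_a k)(w, z)`. -/
def limitKernel (ht : 0 < t) (hk : IsBoundedKernel t M k) (x : MaxIdealSpace n)
    (w z : Cn n) : ℂ := x (shiftBUC ht hk w z)

/-- Every limit kernel is a pointwise limit of shifts along one ultrafilter. -/
theorem exists_ultrafilter_tendsto_limitKernel (ht : 0 < t) (hk : IsBoundedKernel t M k)
    (x : MaxIdealSpace n) : ∃ U : Ultrafilter (Cn n), ∀ w z,
      Tendsto (fun a => shiftKernel t a k w z) U (𝓝 (limitKernel ht hk x w z)) := by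
  obtain ⟨U, hU⟩ := exists_ultrafilter_tendsto x
  exact ⟨U, fun w z => hU (shiftBUC ht hk w z)⟩

theorem continuous_limitKernel_left (ht : 0 < t) (hk : IsBoundedKernel t M k) (w z : Cn n) :
    Continuous fun x => limitKernel ht hk x w z :=
  (WeakDual.eval_continuous (shiftBUC ht hk w z)).comp continuous_subtype_val

theorem isBoundedKernel_limitKernel (ht : 0 < t) (hk : IsBoundedKernel t M k)
    (x : MaxIdealSpace n) : IsBoundedKernel t M (limitKernel ht hk x) := by
  obtain ⟨U, hU⟩ := exists_ultrafilter_tendsto_limitKernel ht hk x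
  have hloc : ∀ c v : Cn n, ∀ u ∈ Metric.ball c 1, ‖u‖ ≤ max ‖v‖ (‖c‖ + 1) := by
    intro c v u hu
    rw [mem_ball_iff_norm] at hu
    have h1 := norm_add_le (u - c) c
    rw [sub_add_cancel] at h1
    exact le_max_of_le_right (by linarith)
  refine ⟨fun w => ?_, fun z => ?_, fun w z => ?_⟩
  · refine differentiable_of_tendsto U (fun a => (hk.shiftKernel ht a).holomorphic w)
      (fun c => ⟨Real.exp (max ‖w‖ (‖c‖ + 1) ^ 2 / t) * M, fun a z hz => ?_⟩) (hU w)
    exact (hk.shiftKernel ht a).norm_le ht hk.nonneg (le_max_left ‖w‖ _) (hloc c w z hz)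
  · refine differentiable_of_tendsto U (fun a => (hk.shiftKernel ht a).antiholomorphic z)
      (fun c => ⟨Real.exp (max ‖z‖ (‖c‖ + 1) ^ 2 / t) * M, fun a w hw => ?_⟩)
      (fun w => (Complex.continuous_conj.tendsto _).comp (hU w z))
    rw [RCLike.norm_conj]
    exact (hk.shiftKernel ht a).norm_le ht hk.nonneg (hloc c z w hw) (le_max_left ‖z‖ _)
  · rw [norm_weightedKernel_le_iff]
    exact le_of_tendsto (hU w z).norm
      (Eventually.of_forall fun a => norm_shiftKernel_le ht hk w z a)

theorem Dominates.limitKernel (ht : 0 < t) (hk : IsBoundedKernel t M k) {H : Cn n → ℝ}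
    (h : Dominates t H k) (x : MaxIdealSpace n) : Dominates t H (limitKernel ht hk x) where
  nonneg := h.nonneg
  integrable := h.integrable
  bound w z := by
    obtain ⟨U, hU⟩ := exists_ultrafilter_tendsto_limitKernel ht hk x
    exact le_of_tendsto (hU w z).norm
      (Eventually.of_forall fun a => (h.shiftKernel ht a).bound w z)

theorem IsBoundedKernel.isWienerKernel (ht : 0 < t) (hk : IsBoundedKernel t M k)
    {H : Cn n → ℝ} (h : Dominates t H k) : IsWienerKernel t k :=
  ⟨(hk.continuous ht).measurable, hk.holomorphic, hk.antiholomorphic, H, h⟩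

/-- Joint continuity: the local Lipschitz estimate in `(w, z)` is uniform in `x`, so continuity in
`x` for fixed `(w, z)` is enough. -/
theorem continuous_limitKernel (ht : 0 < t) (hk : IsBoundedKernel t M k) :
    Continuous fun p : MaxIdealSpace n × (Cn n × Cn n) => limitKernel ht hk p.1 p.2.1 p.2.2 := by
  rw [continuous_iff_continuousAt]
  rintro ⟨x, w, z⟩
  rw [ContinuousAt, tendsto_iff_norm_sub_tendsto_zero]
  set C := 2 * (Real.exp ((max ‖w‖ ‖z‖ + 2) ^ 2 / t) * M) with hC
  have hlim : Tendsto (fun p : MaxIdealSpace n × (Cn n × Cn n) =>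
      C * (‖p.2.1 - w‖ + ‖p.2.2 - z‖) + ‖limitKernel ht hk p.1 w z - limitKernel ht hk x w z‖)
      (𝓝 (x, w, z)) (𝓝 0) := by
    have h0 := (continuous_limitKernel_left ht hk w z).comp
      (continuous_fst : Continuous (Prod.fst : MaxIdealSpace n × (Cn n × Cn n) → _))
    have h0' : Continuous fun p : MaxIdealSpace n × (Cn n × Cn n) =>
      limitKernel ht hk p.1 w z := h0
    have : Continuous fun p : MaxIdealSpace n × (Cn n × Cn n) =>
      C * (‖p.2.1 - w‖ + ‖p.2.2 - z‖) +
        ‖limitKernel ht hk p.1 w z - limitKernel ht hk x w z‖ := by fun_prop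
    simpa using this.tendsto (x, w, z)
  refine squeeze_zero' (Eventually.of_forall fun p => norm_nonneg _) ?_ hlim
  have h1 : ∀ᶠ p : MaxIdealSpace n × (Cn n × Cn n) in 𝓝 (x, w, z), p.2.1 ∈ Metric.ball w 1 :=
    (continuous_fst.comp continuous_snd).continuousAt (Metric.ball_mem_nhds w one_pos)
  have h2 : ∀ᶠ p : MaxIdealSpace n × (Cn n × Cn n) in 𝓝 (x, w, z), p.2.2 ∈ Metric.ball z 1 :=
    (continuous_snd.comp continuous_snd).continuousAt (Metric.ball_mem_nhds z one_pos)
  filter_upwards [h1, h2] with p hp1 hp2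
  have h3 := (isBoundedKernel_limitKernel ht hk p.1).lipschitz ht hk.nonneg (le_max_left _ _)
    (le_max_right _ _) (mem_ball_iff_norm.1 hp1) (mem_ball_iff_norm.1 hp2)
  refine le_trans ?_ (add_le_add_left h3 _)
  exact (norm_sub_le_norm_sub_add_norm_sub _ (limitKernel ht hk p.1 w z) _)

/-- Near a point `y` of the maximal ideal space the weighted limit kernels are uniformly close to
that of `y` on bounded sets. -/
theorem eventually_norm_weightedKernel_limitKernel_sub_le (ht : 0 < t)
    (hk : IsBoundedKernel t M k) (y : MaxIdealSpace n) (R : ℝ) {δ : ℝ} (hδ : 0 < δ) :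
    ∀ᶠ x in 𝓝 y, ∀ w z : Cn n, ‖w‖ ≤ R → ‖z‖ ≤ R →
      ‖weightedKernel t (limitKernel ht hk x) w z - weightedKernel t (limitKernel ht hk y) w z‖
        ≤ δ := by
  -- A jointly continuous family depends on the parameter uniformly on compact sets.
  have hK : IsCompact (Metric.closedBall (0 : Cn n) R ×ˢ Metric.closedBall (0 : Cn n) R) :=
    (isCompact_closedBall _ _).prod (isCompact_closedBall _ _)
  have hc : Continuous (Function.uncurry fun (x : MaxIdealSpace n) (p : Cn n × Cn n) =>
      weightedKernel t (limitKernel ht hk x) p.1 p.2) := by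
    have := continuous_limitKernel ht hk
    unfold weightedKernel Function.uncurry
    fun_prop
  obtain ⟨v, hv, h⟩ := hK.mem_uniformity_of_prod (s := Set.univ) hc.continuousOn
    (Set.mem_univ y) (Metric.dist_mem_uniformity hδ)
  rw [nhdsWithin_univ] at hv
  filter_upwards [hv] with x hx w z hw hz
  have h1 := h x hx (w, z) ⟨by simpa using hw, by simpa using hz⟩
  rw [← dist_eq_norm]
  exact le_of_lt h1

/-! ### Convolution estimates -/

section convolution

/-- The convolution-type integral `∫ g(w) G(w - z) dw` of non-negative functions. -/
def conv (g G : Cn n → ℝ≥0∞) (z : Cn n) : ℝ≥0∞ := ∫⁻ w, g w * G (w - z)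

variable {g G : Cn n → ℝ≥0∞}

theorem measurable_conv (hg : Measurable g) (hG : Measurable G) : Measurable (conv g G) := by
  unfold conv
  exact Measurable.lintegral_prod_left'
    (f := fun p : Cn n × Cn n => g p.1 * G (p.1 - p.2)) (by fun_prop)

theorem conv_le_eLpNorm_top (hG : Measurable G) (z : Cn n) :
    conv g G z ≤ eLpNorm g ⊤ volume * ∫⁻ u, G u := by
  have hae : ∀ᵐ w, g w ≤ eLpNorm g ⊤ volume := by
    simpa using enorm_ae_le_eLpNormEssSup g (volume : Measure (Cn n))
  calc conv g G z ≤ ∫⁻ w, eLpNorm g ⊤ volume * G (w - z) :=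
        lintegral_mono_ae (hae.mono fun w hw => mul_le_mul_left hw _)
    _ = _ := by
      rw [lintegral_const_mul _ (by fun_prop), lintegral_sub_right_eq_self G z]

/-- Young's inequality for convolution with an integrable function. -/
theorem eLpNorm_conv_le {q : ℝ≥0∞} (hq : 1 ≤ q) (hg : Measurable g) (hG : Measurable G) :
    eLpNorm (conv g G) q volume ≤ eLpNorm g q volume * ∫⁻ u, G u := by
  have h0 : q ≠ 0 := (zero_lt_one.trans_le hq).ne'
  rcases eq_or_ne q ⊤ with rfl | hqt
  · rw [eLpNorm_exponent_top]
    exact eLpNormEssSup_le_of_ae_enorm_bound (Eventually.of_forall fun z =>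
      conv_le_eLpNorm_top hG z)
  set p := q.toReal with hp
  have hp1 : 1 ≤ p := by
    rw [hp, ← ENNReal.toReal_one]
    exact ENNReal.toReal_mono hqt hq
  have hp0 : 0 < p := by linarith
  set I := ∫⁻ u, G u with hI
  -- Jensen's inequality for the measure with density `G (w - z)`
  have hpt : ∀ z, conv g G z ^ p ≤ I ^ (p - 1) * ∫⁻ w, g w ^ p * G (w - z) := by
    intro z
    have hm : Measurable fun w => G (w - z) := by fun_prop
    set ν := volume.withDensity fun w => G (w - z) with hν
    have h1 : ∀ F : Cn n → ℝ≥0∞, Measurable F → ∫⁻ w, F w ∂ν = ∫⁻ w, F w * G (w - z) :=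
      fun F hF => by
        rw [hν, lintegral_withDensity_eq_lintegral_mul _ hm hF]
        simp only [Pi.mul_apply, mul_comm]
    have h2 : ν Set.univ = I := by
      rw [hν, withDensity_apply _ MeasurableSet.univ, setLIntegral_univ,
        lintegral_sub_right_eq_self G z]
    have h3 := eLpNorm'_le_eLpNorm'_mul_rpow_measure_univ one_pos hp1
      (hg.aestronglyMeasurable (μ := ν))
    simp only [eLpNorm', enorm_eq_self, ENNReal.rpow_one, div_one, h2] at h3
    rw [h1 g hg, h1 _ (hg.pow_const p)] at h3
    calc conv g G z ^ p ≤ ((∫⁻ w, g w ^ p * G (w - z)) ^ (1 / p) * I ^ (1 - 1 / p)) ^ p :=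
          ENNReal.rpow_le_rpow h3 hp0.le
      _ = _ := by
        rw [ENNReal.mul_rpow_of_nonneg _ _ hp0.le, ← ENNReal.rpow_mul, ← ENNReal.rpow_mul,
          one_div, inv_mul_cancel₀ hp0.ne', ENNReal.rpow_one, sub_mul, one_mul,
          inv_mul_cancel₀ hp0.ne', mul_comm]
  have hint : ∫⁻ z, conv g G z ^ p ≤ I ^ p * ∫⁻ w, g w ^ p := by
    calc ∫⁻ z, conv g G z ^ p ≤ ∫⁻ z, I ^ (p - 1) * ∫⁻ w, g w ^ p * G (w - z) :=
          lintegral_mono hpt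
      _ = I ^ (p - 1) * ∫⁻ z, ∫⁻ w, g w ^ p * G (w - z) := by
          refine lintegral_const_mul _ ?_
          exact Measurable.lintegral_prod_left'
            (f := fun p' : Cn n × Cn n => g p'.1 ^ p * G (p'.1 - p'.2)) (by fun_prop)
      _ = I ^ (p - 1) * ∫⁻ w, ∫⁻ z, g w ^ p * G (w - z) := by
          rw [lintegral_lintegral_swap]
          exact Measurable.aemeasurable (by unfold Function.uncurry; fun_prop)
      _ = I ^ (p - 1) * (I * ∫⁻ w, g w ^ p) := by
          congr 1
          have : ∀ w, ∫⁻ z, g w ^ p * G (w - z) = g w ^ p * I := fun w => by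
            rw [lintegral_const_mul _ (by fun_prop), lintegral_sub_left_eq_self G w]
          simp only [this]
          rw [lintegral_mul_const _ (by fun_prop), mul_comm]
      _ = I ^ p * ∫⁻ w, g w ^ p := by
          rw [← mul_assoc]
          congr 1
          nth_rewrite 2 [← ENNReal.rpow_one I]
          rw [← ENNReal.rpow_add_of_nonneg _ _ (by linarith) zero_le_one, sub_add_cancel]
  rw [eLpNorm_eq_lintegral_rpow_enorm_toReal h0 hqt, eLpNorm_eq_lintegral_rpow_enorm_toReal h0 hqt]
  simp only [enorm_eq_self]
  calc (∫⁻ z, conv g G z ^ p) ^ (1 / p) ≤ (I ^ p * ∫⁻ w, g w ^ p) ^ (1 / p) :=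
        ENNReal.rpow_le_rpow hint (by positivity)
    _ = _ := by
      rw [ENNReal.mul_rpow_of_nonneg _ _ (by positivity), ← ENNReal.rpow_mul,
        mul_one_div_cancel hp0.ne', ENNReal.rpow_one, mul_comm]

/-- The complement of the closed ball of radius `R` about the origin. -/
def far (n : ℕ) (R : ℝ) : Set (Cn n) := {w | R < ‖w‖}

theorem measurableSet_far (R : ℝ) : MeasurableSet (far n R) :=
  measurableSet_lt measurable_const measurable_norm

theorem tendsto_setLIntegral_far (hG : ∫⁻ u, G u ≠ ⊤) :
    Tendsto (fun R : ℕ => ∫⁻ u in far n R, G u) atTop (𝓝 0) := by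
  have hfin : (volume.withDensity G) (far n ((0 : ℕ) : ℝ)) ≠ ⊤ := by
    rw [withDensity_apply _ (measurableSet_far _)]
    exact ne_top_of_le_ne_top hG (setLIntegral_le_lintegral _ _)
  have h := tendsto_measure_iInter_atTop (μ := volume.withDensity G)
    (s := fun R : ℕ => far n R) (fun R => (measurableSet_far _).nullMeasurableSet)
    (fun a b hab w hw => lt_of_le_of_lt (Nat.cast_le.2 hab) (show (b : ℝ) < ‖w‖ from hw)) ⟨0, hfin⟩
  have he : ⋂ R : ℕ, far n R = ∅ := by
    ext w
    simp only [Set.mem_iInter, Set.mem_empty_iff_false, iff_false, not_forall]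
    obtain ⟨N, hN⟩ := exists_nat_ge ‖w‖
    exact ⟨N, not_lt.2 hN⟩
  rw [he, measure_empty] at h
  exact h.congr fun R => withDensity_apply _ (measurableSet_far _)

/-- Splitting a kernel dominated by `G (w - z)` into a part that acts on the tail of `g`, a part
far from the diagonal, and a part that lives on a bounded set. -/
theorem lintegral_mul_le_conv_far (D : Cn n → ℝ≥0∞) {δ : ℝ≥0∞} {R : ℝ}
    (hg : Measurable g) (hG : Measurable G) (z : Cn n)
    (hD : ∀ᵐ w, D w ≤ G (w - z)) (hδ : ‖z‖ ≤ 2 * R → ∀ w, ‖w‖ ≤ R → D w ≤ δ) :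
    ∫⁻ w, g w * D w ≤ conv ((far n R).indicator g) G z + conv g ((far n R).indicator G) z +
      (Metric.closedBall (0 : Cn n) (2 * R)).indicator
        (fun _ => (∫⁻ w in Metric.closedBall (0 : Cn n) R, g w) * δ) z := by
  have hfar := measurableSet_far (n := n) R
  set B := Metric.closedBall (0 : Cn n) R
  set c : ℝ≥0∞ := (Metric.closedBall (0 : Cn n) (2 * R)).indicator (fun _ => δ) z with hc
  have h3 : (Metric.closedBall (0 : Cn n) (2 * R)).indicator
      (fun _ => (∫⁻ w in B, g w) * δ) z = ∫⁻ w, B.indicator g w * c := by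
    rw [lintegral_mul_const _ (hg.indicator measurableSet_closedBall),
      lintegral_indicator measurableSet_closedBall, hc]
    by_cases hz : z ∈ Metric.closedBall (0 : Cn n) (2 * R) <;> simp [hz, B]
  have hm1 : Measurable fun w => (far n R).indicator g w * G (w - z) :=
    (hg.indicator hfar).mul (by fun_prop)
  have hm2 : Measurable fun w => g w * (far n R).indicator G (w - z) :=
    hg.mul ((hG.indicator hfar).comp (measurable_id.sub_const z))
  have hm3 : Measurable fun w => (far n R).indicator g w * G (w - z) +
      g w * (far n R).indicator G (w - z) := hm1.add hm2
  rw [h3, conv, conv, ← lintegral_add_left hm1, ← lintegral_add_left hm3]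
  refine lintegral_mono_ae (hD.mono fun w hw => ?_)
  by_cases h1 : w ∈ far n R
  · rw [Set.indicator_of_mem h1, add_assoc]
    exact (mul_le_mul_right hw _).trans le_self_add
  by_cases h2 : w - z ∈ far n R
  · rw [Set.indicator_of_mem h2]
    exact (mul_le_mul_right hw _).trans (le_add_left le_rfl |>.trans le_self_add)
  · have hw1 : ‖w‖ ≤ R := not_lt.1 h1
    have hz1 : ‖z‖ ≤ 2 * R := by
      have h3 : ‖w - z‖ ≤ R := not_lt.1 h2
      have := norm_sub_le w (w - z)
      rw [sub_sub_cancel] at this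
      linarith
    have hzB : z ∈ Metric.closedBall (0 : Cn n) (2 * R) := by simpa using hz1
    have hwB : w ∈ B := by simpa [B] using hw1
    rw [hc, Set.indicator_of_mem hzB, Set.indicator_of_mem hwB]
    exact (mul_le_mul_right (hδ hz1 w hw1) _).trans (le_add_left le_rfl)

end convolution

variable {κ : Kind}

/-! ### The Fock norms as `L^p` norms -/

/-- The Lebesgue exponent that belongs to a Fock space. -/
def Kind.exponent : Kind → ℝ≥0∞
  | .pow p _ => ENNReal.ofReal p
  | .infty => ⊤
  | .vanish => ⊤

/-- The normalizing factor between the Fock norm and the `L^p` norm of the weighted function. -/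
def Kind.factor (n : ℕ) (t : ℝ) : Kind → ℝ
  | .pow p _ => ((p / (2 * Real.pi * t)) ^ n) ^ (1 / p)
  | .infty => 1
  | .vanish => 1

theorem Kind.one_le_exponent (κ : Kind) : 1 ≤ κ.exponent := by
  cases κ with
  | pow p hp => simpa [Kind.exponent] using hp
  | infty => exact le_top
  | vanish => exact le_top

theorem Kind.factor_nonneg (ht : 0 < t) (κ : Kind) : 0 ≤ κ.factor n t := by
  have hpi := Real.pi_pos
  cases κ with
  | pow p hp =>
    have : 0 < p := by linarith
    simp only [Kind.factor]; positivity
  | infty => exact zero_le_one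
  | vanish => exact zero_le_one

/-- For a continuous function the essential supremum bounds every value. -/
theorem enorm_le_eLpNorm_top {u : Cn n → ℂ} (hu : Continuous u) (z : Cn n) :
    ‖u z‖ₑ ≤ eLpNorm u ⊤ volume := by
  rw [eLpNorm_exponent_top]
  have hd := (Measure.dense_of_ae (enorm_ae_le_eLpNormEssSup u (volume : Measure (Cn n))))
  have hc : IsClosed {w | ‖u w‖ₑ ≤ eLpNormEssSup u volume} :=
    isClosed_le hu.enorm continuous_const
  exact hc.closure_subset_iff.2 subset_rfl (hd z)

theorem memLp_top_of_bddAbove {u : Cn n → ℂ} (hu : Continuous u)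
    (hb : BddAbove (Set.range fun z => ‖u z‖)) : MemLp u ⊤ volume := by
  obtain ⟨C, hC⟩ := hb
  exact memLp_top_of_bound hu.aestronglyMeasurable C (Eventually.of_forall fun z => hC ⟨z, rfl⟩)

theorem iSup_norm_eq_eLpNorm_top {u : Cn n → ℂ} (hu : Continuous u)
    (hb : BddAbove (Set.range fun z => ‖u z‖)) :
    ⨆ z, ‖u z‖ = (eLpNorm u ⊤ volume).toReal := by
  have hm := memLp_top_of_bddAbove hu hb
  refine le_antisymm (ciSup_le fun z => ?_) ?_
  · rw [← toReal_enorm]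
    exact ENNReal.toReal_mono hm.2.ne (enorm_le_eLpNorm_top hu z)
  · have h0 : 0 ≤ ⨆ z, ‖u z‖ := Real.iSup_nonneg fun z => norm_nonneg _
    refine ENNReal.toReal_le_of_le_ofReal h0 ?_
    rw [eLpNorm_exponent_top]
    refine eLpNormEssSup_le_of_ae_bound (Eventually.of_forall fun z => le_ciSup hb z)

namespace FockSpace

theorem continuous_weighted (f : FockSpace n t κ) : Continuous (weighted t f) :=
  Fock.continuous_weighted f.differentiable

theorem memLp (f : FockSpace n t κ) : MemLp (weighted t f) κ.exponent volume := by
  cases κ with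
  | pow p hp => exact (growth_pow_iff hp f.differentiable).1 f.growth
  | infty => exact memLp_top_of_bddAbove f.continuous_weighted f.bddAbove_infty
  | vanish => exact memLp_top_of_bddAbove f.continuous_weighted f.bddAbove_vanish

theorem norm_eq [ht : Fact (0 < t)] (f : FockSpace n t κ) :
    ‖f‖ = κ.factor n t * (eLpNorm (weighted t f) κ.exponent volume).toReal := by
  cases κ with
  | pow p hp => exact fockNorm_pow_eq hp ht.out f.differentiable f.growth
  | infty =>
    simp only [norm_def, fockNorm, ← norm_weighted, Kind.factor, Kind.exponent, one_mul]
    exact iSup_norm_eq_eLpNorm_top f.continuous_weighted f.bddAbove_infty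
  | vanish =>
    simp only [norm_def, fockNorm, ← norm_weighted, Kind.factor, Kind.exponent, one_mul]
    exact iSup_norm_eq_eLpNorm_top f.continuous_weighted f.bddAbove_vanish

/-- Functions in any Fock space are bounded after weighting. -/
theorem exists_norm_weighted_le (ht : 0 < t) (f : FockSpace n t κ) :
    ∃ C, ∀ z, ‖weighted t f z‖ ≤ C := by
  set B := Metric.ball (0 : Cn n) 1
  set I : ℝ≥0∞ := eLpNorm (weighted t f) κ.exponent volume *
    (volume B) ^ (1 / (1 : ℝ≥0∞).toReal - 1 / κ.exponent.toReal) with hI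
  have hpos : 0 ≤ 1 / (1 : ℝ≥0∞).toReal - 1 / κ.exponent.toReal := by
    rw [ENNReal.toReal_one, div_one, sub_nonneg]
    rcases eq_or_ne κ.exponent ⊤ with h | h
    · simp [h]
    · have : 1 ≤ κ.exponent.toReal := by
        rw [← ENNReal.toReal_one]
        exact ENNReal.toReal_mono h κ.one_le_exponent
      exact div_le_one_of_le₀ this (by linarith)
  have hIt : I ≠ ⊤ := by
    refine ENNReal.mul_ne_top f.memLp.2.ne ?_
    exact ENNReal.rpow_ne_top_of_nonneg hpos measure_ball_lt_top.ne
  refine ⟨meanConst n t * I.toReal, fun z => ?_⟩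
  refine (norm_weighted_le ht f.differentiable z).trans
    (mul_le_mul_of_nonneg_left ?_ (meanConst_nonneg n t))
  have hc : Continuous fun w => weighted t f (z + w) :=
    f.continuous_weighted.comp (continuous_const_add z)
  rw [integral_norm_eq_lintegral_enorm hc.aestronglyMeasurable]
  refine ENNReal.toReal_mono hIt ?_
  have h1 := eLpNorm_le_eLpNorm_mul_rpow_measure_univ (μ := volume.restrict B)
    κ.one_le_exponent hc.aestronglyMeasurable
  rw [eLpNorm_one_eq_lintegral_enorm, Measure.restrict_apply_univ] at h1
  refine h1.trans ?_
  refine mul_le_mul_left ?_ _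
  refine (eLpNorm_mono_measure _ Measure.restrict_le_self).trans ?_
  refine (eLpNorm_comp_measurePreserving f.memLp.1 (measurePreserving_add_left volume z)).le

end FockSpace

/-- Outside large balls, functions in a Fock space other than `F_t^∞` are small in norm. -/
theorem FockSpace.tendsto_eLpNorm_far (hκ : κ ≠ .infty) (f : FockSpace n t κ) :
    Tendsto (fun R : ℕ => eLpNorm ((far n R).indicator fun w => ‖weighted t f w‖ₑ)
      κ.exponent volume) atTop (𝓝 0) := by
  cases κ with
  | infty => exact absurd rfl hκ
  | pow p hp =>
    have hp0 : 0 < p := by linarith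
    have h0 : ENNReal.ofReal p ≠ 0 := by simpa using hp0
    have hfin := f.memLp.2
    simp only [Kind.exponent] at hfin ⊢
    rw [eLpNorm_lt_top_iff_lintegral_rpow_enorm_lt_top h0 ENNReal.ofReal_ne_top,
      ENNReal.toReal_ofReal hp0.le] at hfin
    have h := ((ENNReal.continuous_rpow_const (y := 1 / p)).tendsto 0).comp
      (tendsto_setLIntegral_far hfin.ne)
    rw [ENNReal.zero_rpow_of_pos (by positivity)] at h
    refine h.congr fun R => ?_
    rw [eLpNorm_eq_lintegral_rpow_enorm_toReal h0 ENNReal.ofReal_ne_top,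
      ENNReal.toReal_ofReal hp0.le, Function.comp_apply,
      ← lintegral_indicator (measurableSet_far _)]
    congr 2
    funext w
    by_cases hw : w ∈ far n R <;> simp [hw, hp0]
  | vanish =>
    have hv := growth_vanish_iff.1 f.growth
    rw [ENNReal.tendsto_nhds_zero]
    intro ε hε
    have h1 : ∀ᶠ w in cocompact (Cn n), ‖weighted t f w‖ₑ ≤ ε := by
      have := (continuous_enorm.tendsto (0 : ℂ)).comp hv
      rw [enorm_zero] at this
      exact (ENNReal.tendsto_nhds_zero.1 this) ε hε
    rw [← Metric.cobounded_eq_cocompact, ← comap_norm_atTop, eventually_comap,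
      eventually_atTop] at h1
    obtain ⟨r, hr⟩ := h1
    obtain ⟨N, hN⟩ := exists_nat_ge r
    filter_upwards [eventually_ge_atTop N] with R hR
    simp only [Kind.exponent, eLpNorm_exponent_top]
    refine eLpNormEssSup_le_of_ae_enorm_bound (Eventually.of_forall fun w => ?_)
    rw [enorm_eq_self]
    by_cases hw : w ∈ far n R
    · rw [Set.indicator_of_mem hw]
      have h2 : (R : ℝ) < ‖w‖ := hw
      have h3 : (N : ℝ) ≤ R := Nat.cast_le.2 hR
      exact hr ‖w‖ (by linarith) w rfl
    · simp [hw]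

/-! ### Integral operators -/

/-- The function `z ↦ ∫ f(w) k(w, z) dμ_t(w)`. -/
def integralFun (t : ℝ) (k : Cn n → Cn n → ℂ) (f : Cn n → ℂ) (z : Cn n) : ℂ :=
  ∫ w, f w * k w z ∂(gaussian n t)

/-- The Gaussian density distributes over the weights of `f` and `k`, up to a factor depending on
`z`. -/
theorem gaussian_density_mul (ht : 0 < t) (f : Cn n → ℂ) (w z : Cn n) :
    ((((Real.pi * t) ^ n)⁻¹ * Real.exp (-‖w‖ ^ 2 / t) : ℝ) : ℂ) * (f w * k w z) =
      ((((Real.pi * t) ^ n)⁻¹ * Real.exp (‖z‖ ^ 2 / (2 * t)) : ℝ) : ℂ) *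
        (weighted t f w * weightedKernel t k w z) := by
  have e : Real.exp (-‖w‖ ^ 2 / t) = Real.exp (‖z‖ ^ 2 / (2 * t)) *
      (Real.exp (-‖w‖ ^ 2 / (2 * t)) * Real.exp (-(‖z‖ ^ 2 + ‖w‖ ^ 2) / (2 * t))) := by
    rw [← Real.exp_add, ← Real.exp_add]
    congr 1
    field_simp
    ring
  rw [e, weighted, weightedKernel]
  push_cast
  ring

theorem weighted_integralFun (ht : 0 < t) (f : Cn n → ℂ) (z : Cn n) :
    weighted t (integralFun t k f) z =
      ((((Real.pi * t) ^ n)⁻¹ : ℝ) : ℂ) * ∫ w, weighted t f w * weightedKernel t k w z := by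
  rw [weighted, integralFun, integral_gaussian ht]
  simp only [gaussian_density_mul ht]
  rw [integral_const_mul]
  push_cast
  rw [mul_assoc, mul_assoc, mul_comm (∫ w, _), ← mul_assoc (Complex.exp _), ← Complex.exp_add]
  rw [show ((‖z‖ : ℝ) : ℂ) ^ 2 / (2 * t) + -((‖z‖ : ℝ) : ℂ) ^ 2 / (2 * t) = 0 by ring]
  simp

theorem enorm_weighted_integralFun_le (ht : 0 < t) (f : Cn n → ℂ) (z : Cn n) :
    ‖weighted t (integralFun t k f) z‖ₑ ≤ ‖((Real.pi * t) ^ n)⁻¹‖ₑ *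
      ∫⁻ w, ‖weighted t f w‖ₑ * ‖weightedKernel t k w z‖ₑ := by
  rw [weighted_integralFun ht, enorm_mul]
  refine mul_le_mul' (by simp [enorm]) ?_
  refine (enorm_integral_le_lintegral_enorm _).trans_eq ?_
  simp only [enorm_mul]

/-- A measurable version of the dominating function, valid for all kernels that it dominates. -/
theorem exists_measurable_majorant {H : Cn n → ℝ} (hH : Integrable H) :
    ∃ G : Cn n → ℝ≥0∞, Measurable G ∧ ∫⁻ u, G u ≠ ⊤ ∧ ∀ k : Cn n → Cn n → ℂ, Dominates t H k →
      ∀ z, ∀ᵐ w, ‖weightedKernel t k w z‖ₑ ≤ G (w - z) := by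
  have hm : AEMeasurable (fun u => ‖H u‖ₑ) volume := hH.1.enorm
  refine ⟨hm.mk _, hm.measurable_mk, ?_, fun k hk z => ?_⟩
  · rw [← lintegral_congr_ae hm.ae_eq_mk]
    exact hH.2.ne
  · have h1 := (measurePreserving_sub_right (volume : Measure (Cn n)) z).quasiMeasurePreserving.ae
      hm.ae_eq_mk
    filter_upwards [h1] with w hw
    rw [← hw, enorm_le_iff_norm_le]
    exact (hk.norm_weightedKernel_le w z).trans (Real.le_norm_self _)

theorem measurable_enorm_weighted {f : Cn n → ℂ} (hf : Differentiable ℂ f) :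
    Measurable fun w => ‖weighted t f w‖ₑ :=
  (continuous_weighted hf).enorm.measurable

theorem measurable_weightedKernel (hk : Measurable (Function.uncurry k)) :
    Measurable (Function.uncurry (weightedKernel t k)) := by
  have : Continuous fun p : Cn n × Cn n =>
      ((Real.exp (-(‖p.2‖ ^ 2 + ‖p.1‖ ^ 2) / (2 * t)) : ℝ) : ℂ) := by fun_prop
  exact hk.mul this.measurable

theorem integrable_weighted_mul (hk : IsWienerKernel t k) {f : Cn n → ℂ}
    (hf : Differentiable ℂ f) {C : ℝ} (hC : ∀ z, ‖weighted t f z‖ ≤ C) (z : Cn n) :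
    Integrable fun w => weighted t f w * weightedKernel t k w z := by
  obtain ⟨H, hH⟩ := hk.dominated
  have h1 : Integrable fun w => C * H (w - z) := (hH.integrable.comp_sub_right z).const_mul C
  refine h1.mono' ?_ (Eventually.of_forall fun w => ?_)
  · refine (continuous_weighted hf).aestronglyMeasurable.mul ?_
    exact ((measurable_weightedKernel hk.measurable).comp
      (measurable_id.prodMk measurable_const)).aestronglyMeasurable
  · rw [norm_mul]
    exact mul_le_mul (hC w) (hH.norm_weightedKernel_le w z) (norm_nonneg _)
      ((norm_nonneg _).trans (hC w))

theorem integrable_gaussian_mul (ht : 0 < t) (hk : IsWienerKernel t k) {f : Cn n → ℂ}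
    (hf : Differentiable ℂ f) {C : ℝ} (hC : ∀ z, ‖weighted t f z‖ ≤ C) (z : Cn n) :
    Integrable (fun w => f w * k w z) (gaussian n t) := by
  rw [integrable_gaussian_iff ht]
  simp only [gaussian_density_mul ht]
  exact (integrable_weighted_mul hk hf hC z).const_mul _

/-- Differentiation under the integral sign. The derivative of `k(w, ·)` near `z₀` is controlled,
through the Cauchy estimate and the sub-mean value property, by the integral of the dominating
function over a ball, which is integrable in `w`. -/
theorem differentiable_integralFun (ht : 0 < t) (hk : IsWienerKernel t k) {f : Cn n → ℂ}
    (hf : Differentiable ℂ f) {C : ℝ} (hC : ∀ z, ‖weighted t f z‖ ≤ C) :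
    Differentiable ℂ (integralFun t k f) := by
  intro z₀
  obtain ⟨H, hH⟩ := hk.dominated
  have hpi := Real.pi_pos
  have hkb := hH.isBoundedKernel ht hk
  have hkc := hkb.continuous ht
  set a : Cn n → ℂ := fun w => ((((Real.pi * t) ^ n)⁻¹ * Real.exp (-‖w‖ ^ 2 / t) : ℝ) : ℂ) * f w
    with ha
  have hac : Continuous a := by
    have := hf.continuous
    fun_prop
  have haC : ∀ w, ‖a w‖ * Real.exp (‖w‖ ^ 2 / (2 * t)) ≤ ((Real.pi * t) ^ n)⁻¹ * C := by
    intro w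
    have h1 := hC w
    rw [norm_weighted] at h1
    rw [ha]
    simp only
    rw [norm_mul, Complex.norm_real, Real.norm_of_nonneg (by positivity)]
    have e : Real.exp (-‖w‖ ^ 2 / t) * Real.exp (‖w‖ ^ 2 / (2 * t)) =
        Real.exp (-‖w‖ ^ 2 / (2 * t)) := by
      rw [← Real.exp_add]; congr 1; field_simp; ring
    calc _ = ((Real.pi * t) ^ n)⁻¹ * (‖f w‖ *
          (Real.exp (-‖w‖ ^ 2 / t) * Real.exp (‖w‖ ^ 2 / (2 * t)))) := by ring
      _ ≤ _ := by rw [e]; gcongr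
  set J : Cn n → ℝ := fun w => ∫ v in Metric.ball z₀ 3, H (w - v) with hJ
  have hJi : Integrable J := by
    have h1 : Integrable ((Metric.ball z₀ 3).indicator fun _ : Cn n => (1 : ℝ)) :=
      (integrable_indicator_iff measurableSet_ball).2
        (integrableOn_const measure_ball_lt_top.ne)
    have h2 := (h1.convolution_integrand (ContinuousLinearMap.mul ℝ ℝ)
      hH.integrable).integral_prod_left
    refine h2.congr (Eventually.of_forall fun w => ?_)
    simp only [hJ]
    rw [← integral_indicator measurableSet_ball]
    congr 1
    funext v
    by_cases hv : v ∈ Metric.ball z₀ 3 <;> simp [hv]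
  set r := ‖z₀‖ + 2 with hr
  have hkJ : ∀ w, ∀ z ∈ Metric.ball z₀ 2,
      ‖k w z‖ ≤ Real.exp (r ^ 2 / (2 * t)) * Real.exp (‖w‖ ^ 2 / (2 * t)) *
        (meanConst n t * J w) := by
    intro w z hz
    have hzr : ‖z‖ ≤ r := by
      rw [mem_ball_iff_norm] at hz
      have := norm_add_le (z - z₀) z₀
      rw [sub_add_cancel] at this
      linarith
    have h1 := hH.norm_weightedKernel_le_mean ht hk.holomorphic w z
    have hi : Integrable fun v => H (w - v) := hH.integrable.comp_sub_left w
    have h2 : ∫ u in Metric.ball (0 : Cn n) 1, H (w - (z + u)) ≤ J w := by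
      have e := (measurePreserving_add_left volume z).setIntegral_preimage_emb
        (measurableEmbedding_addLeft z) (fun v => H (w - v)) (Metric.ball z 1)
      have e2 : (fun x => z + x) ⁻¹' Metric.ball z 1 = Metric.ball (0 : Cn n) 1 := by
        ext u; simp
      rw [e2] at e
      rw [e]
      refine setIntegral_mono_set hi.integrableOn (Eventually.of_forall fun v => hH.nonneg _)
        (LE.le.eventuallyLE (Metric.ball_subset_ball' ?_))
      rw [Metric.mem_ball] at hz
      linarith
    have h3 := (norm_weightedKernel_le_iff w z).1
      (h1.trans (mul_le_mul_of_nonneg_left h2 (meanConst_nonneg n t)))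
    refine h3.trans (mul_le_mul_of_nonneg_right ?_ (mul_nonneg (meanConst_nonneg n t)
      (integral_nonneg fun v => hH.nonneg _)))
    rw [← Real.exp_add, ← add_div]
    refine Real.exp_le_exp.2 ?_
    gcongr
  have hcw : ∀ z, Continuous fun w => k w z := fun z =>
    hkc.comp (continuous_id.prodMk continuous_const)
  have key : HasFDerivAt (fun z => ∫ w, a w * k w z) (∫ w, a w • fderiv ℂ (k w) z₀) z₀ := by
    refine hasFDerivAt_integral_of_dominated_of_fderiv_le (s := Metric.ball z₀ 1)
      (F := fun z w => a w * k w z) (F' := fun z w => a w • fderiv ℂ (k w) z)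
      (bound := fun w => ((Real.pi * t) ^ n)⁻¹ * C *
        (2 * (Real.exp (r ^ 2 / (2 * t)) * (meanConst n t * J w))))
      (Metric.ball_mem_nhds _ one_pos)
      (Eventually.of_forall fun z => (hac.mul (hcw z)).aestronglyMeasurable) ?_ ?_
      (Eventually.of_forall fun w z hz => ?_) ?_
      (Eventually.of_forall fun w z hz => ((hk.holomorphic w z).hasFDerivAt).const_mul (a w))
    · have := integrable_gaussian_mul ht hk hf hC z₀
      rw [integrable_gaussian_iff ht] at this
      simpa only [ha, mul_assoc] using this
    · have h1 := measurable_fderiv_with_param ℂ hkc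
      have h2 : Measurable fun w => fderiv ℂ (k w) z₀ :=
        h1.comp (measurable_id.prodMk measurable_const)
      exact hac.aestronglyMeasurable.smul h2.aestronglyMeasurable
    · have h1 := norm_fderiv_le_of_entire_of_bound (hk.holomorphic w) (c := z)
        (M := Real.exp (r ^ 2 / (2 * t)) * Real.exp (‖w‖ ^ 2 / (2 * t)) *
        (meanConst n t * J w)) (fun v hv => hkJ w v (by
          rw [Metric.mem_ball] at *
          linarith [dist_triangle v z z₀]))
      rw [norm_smul]
      have hJ0 : 0 ≤ meanConst n t * J w :=
        mul_nonneg (meanConst_nonneg n t) (integral_nonneg fun v => hH.nonneg _)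
      calc ‖a w‖ * ‖fderiv ℂ (k w) z‖ ≤ ‖a w‖ * (2 * (Real.exp (r ^ 2 / (2 * t)) *
            Real.exp (‖w‖ ^ 2 / (2 * t)) * (meanConst n t * J w))) :=
            mul_le_mul_of_nonneg_left h1 (norm_nonneg _)
        _ = (‖a w‖ * Real.exp (‖w‖ ^ 2 / (2 * t))) * (2 * (Real.exp (r ^ 2 / (2 * t)) *
            (meanConst n t * J w))) := by ring
        _ ≤ _ := mul_le_mul_of_nonneg_right (haC w) (by positivity)
    · exact (((hJi.const_mul _).const_mul _).const_mul _).const_mul _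
  have e : integralFun t k f = fun z => ∫ w, a w * k w z := by
    funext z
    rw [integralFun, integral_gaussian ht]
    simp only [ha, mul_assoc]
  rw [e]
  exact key.differentiableAt

theorem eLpNorm_le_mul_of_enorm_le {u : Cn n → ℂ} {F : Cn n → ℝ≥0∞} {a : ℝ≥0∞} (ha : a ≠ ⊤)
    (h : ∀ z, ‖u z‖ₑ ≤ a * F z) (q : ℝ≥0∞) :
    eLpNorm u q volume ≤ a * eLpNorm F q volume := by
  lift a to NNReal using ha
  have := eLpNorm_le_nnreal_smul_eLpNorm_of_ae_le_mul' (μ := (volume : Measure (Cn n))) (f := u)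
    (g := F) (c := a) (Eventually.of_forall fun z => by simpa using h z) q
  simpa [ENNReal.smul_def] using this

/-- The `L^q` bound for integral operators that Young's inequality gives. -/
theorem eLpNorm_weighted_integralFun_le (ht : 0 < t) {G : Cn n → ℝ≥0∞} (hG : Measurable G)
    (hkG : ∀ z, ∀ᵐ w, ‖weightedKernel t k w z‖ₑ ≤ G (w - z)) {f : Cn n → ℂ}
    (hf : Differentiable ℂ f) {q : ℝ≥0∞} (hq : 1 ≤ q) :
    eLpNorm (weighted t (integralFun t k f)) q volume ≤
      ‖((Real.pi * t) ^ n)⁻¹‖ₑ * (eLpNorm (weighted t f) q volume * ∫⁻ u, G u) := by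
  have h1 := eLpNorm_le_mul_of_enorm_le (n := n) (u := weighted t (integralFun t k f))
    (F := conv (fun w => ‖weighted t f w‖ₑ) G) (a := ‖((Real.pi * t) ^ n)⁻¹‖ₑ) enorm_ne_top
    (fun z => (enorm_weighted_integralFun_le ht f z).trans (mul_le_mul_right
      (lintegral_mono_ae ((hkG z).mono fun w hw => mul_le_mul_right hw _)) _)) q
  refine h1.trans (mul_le_mul_right ?_ _)
  have h2 := eLpNorm_conv_le hq (measurable_enorm_weighted (t := t) hf) hG
  rwa [eLpNorm_enorm] at h2

/-- The two tail terms in `lintegral_mul_le_conv_far` tend to zero. -/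
theorem FockSpace.tendsto_tail (hκ : κ ≠ .infty) (f : FockSpace n t κ) {G : Cn n → ℝ≥0∞}
    (hGi : ∫⁻ u, G u ≠ ⊤) :
    Tendsto (fun R : ℕ => eLpNorm ((far n R).indicator fun w => ‖weighted t f w‖ₑ)
      κ.exponent volume * (∫⁻ u, G u) + eLpNorm (weighted t f) κ.exponent volume *
        ∫⁻ u, (far n R).indicator G u) atTop (𝓝 0) := by
  have h1 := ENNReal.Tendsto.mul_const (b := ∫⁻ u, G u) (f.tendsto_eLpNorm_far hκ) (Or.inr hGi)
  have h2 := ENNReal.Tendsto.const_mul (a := eLpNorm (weighted t f) κ.exponent volume)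
    (tendsto_setLIntegral_far hGi) (Or.inr f.memLp.2.ne)
  have h3 := h1.add h2
  simp only [zero_mul, mul_zero, add_zero] at h3
  simpa only [lintegral_indicator (measurableSet_far _)] using h3

/-- Integral operators preserve each growth condition; vanishing at infinity needs the tail
estimate, the other two follow from the `L^q` bound. -/
theorem growth_integralFun (ht : 0 < t) (hk : IsWienerKernel t k) (f : FockSpace n t κ) :
    Growth n t κ (integralFun t k f) := by
  obtain ⟨H, hH⟩ := hk.dominated
  obtain ⟨C, hC⟩ := f.exists_norm_weighted_le ht
  obtain ⟨G, hG, hGi, hGk⟩ := exists_measurable_majorant (t := t) hH.integrable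
  have hd := differentiable_integralFun ht hk f.differentiable hC
  have hc := continuous_weighted (t := t) hd
  have hle := eLpNorm_weighted_integralFun_le ht hG (hGk k hH) f.differentiable κ.one_le_exponent
  have hfin : eLpNorm (weighted t (integralFun t k f)) κ.exponent volume < ⊤ :=
    hle.trans_lt (ENNReal.mul_lt_top enorm_lt_top
      (ENNReal.mul_lt_top f.memLp.2 hGi.lt_top))
  cases κ with
  | pow p hp => exact (growth_pow_iff hp hd).2 ⟨hc.aestronglyMeasurable, hfin⟩
  | infty =>
    rw [growth_infty_iff]
    refine ⟨(eLpNorm (weighted t (integralFun t k f)) ⊤ volume).toReal, ?_⟩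
    rintro _ ⟨z, rfl⟩
    show ‖weighted t (integralFun t k f) z‖ ≤ _
    rw [← toReal_enorm]
    exact ENNReal.toReal_mono hfin.ne (enorm_le_eLpNorm_top hc z)
  | vanish =>
    rw [growth_vanish_iff, tendsto_zero_iff_enorm_tendsto_zero]
    rw [ENNReal.tendsto_nhds_zero]
    intro ε hε
    have h1 := ENNReal.Tendsto.const_mul (a := ‖((Real.pi * t) ^ n)⁻¹‖ₑ)
      (f.tendsto_tail (by simp) hGi) (Or.inr enorm_ne_top)
    rw [mul_zero] at h1
    obtain ⟨R, hR⟩ := ((ENNReal.tendsto_nhds_zero.1 h1) ε hε).exists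
    have h2 : ∀ᶠ z in cocompact (Cn n), z ∉ Metric.closedBall (0 : Cn n) (2 * R) :=
      (isCompact_closedBall _ _).compl_mem_cocompact
    -- With `δ = ⊤` the third term of the splitting still vanishes for `‖z‖ > 2R`.
    filter_upwards [h2] with z hz
    refine (enorm_weighted_integralFun_le ht f z).trans (le_trans ?_ hR)
    refine mul_le_mul_right ?_ _
    have hm := measurable_enorm_weighted (t := t) f.differentiable
    refine (lintegral_mul_le_conv_far (fun w => ‖weightedKernel t k w z‖ₑ) (R := R) (δ := ⊤)
      hm hG z (hGk k hH z)
      (fun _ _ _ => le_top)).trans ?_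
    rw [Set.indicator_of_notMem hz, add_zero]
    refine add_le_add (conv_le_eLpNorm_top hG z) ?_
    have := conv_le_eLpNorm_top (g := fun w => ‖weighted t f w‖ₑ)
      (hG.indicator (measurableSet_far (n := n) R)) z
    rwa [eLpNorm_enorm] at this

/-- Every kernel in `𝒲_t` defines a bounded operator on every Fock space. -/
theorem exists_isIntegralOp [ht : Fact (0 < t)] (κ : Kind) (hk : IsWienerKernel t k) :
    ∃ A : Op n t κ, IsIntegralOp k A := by
  obtain ⟨H, hH⟩ := hk.dominated
  obtain ⟨G, hG, hGi, hGk⟩ := exists_measurable_majorant (t := t) hH.integrable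
  have hint : ∀ (f : FockSpace n t κ) z, Integrable (fun w => f w * k w z) (gaussian n t) :=
    fun f z => by
      obtain ⟨C, hC⟩ := f.exists_norm_weighted_le ht.out
      exact integrable_gaussian_mul ht.out hk f.differentiable hC z
  let L : FockSpace n t κ →ₗ[ℂ] FockSpace n t κ :=
    { toFun := fun f => ⟨integralFun t k f, by
        obtain ⟨C, hC⟩ := f.exists_norm_weighted_le ht.out
        exact differentiable_integralFun ht.out hk f.differentiable hC,
        growth_integralFun ht.out hk f⟩
      map_add' := fun f g => FockSpace.ext fun z => by
        show integralFun t k (⇑(f + g)) z = integralFun t k f z + integralFun t k g z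
        simp only [integralFun, FockSpace.coe_add, Pi.add_apply, add_mul]
        exact integral_add (hint f z) (hint g z)
      map_smul' := fun c f => FockSpace.ext fun z => by
        show integralFun t k (⇑(c • f)) z = c * integralFun t k f z
        simp only [integralFun, FockSpace.coe_smul, Pi.smul_apply, smul_eq_mul, mul_assoc]
        exact integral_const_mul c _ }
  refine ⟨L.mkContinuous (‖((Real.pi * t) ^ n)⁻¹‖ₑ * ∫⁻ u, G u).toReal fun f => ?_,
    fun f z => rfl⟩
  rw [FockSpace.norm_eq, FockSpace.norm_eq, mul_left_comm, ← ENNReal.toReal_mul]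
  refine mul_le_mul_of_nonneg_left ?_ (κ.factor_nonneg ht.out)
  refine ENNReal.toReal_mono ?_ ?_
  · exact ENNReal.mul_ne_top (ENNReal.mul_ne_top enorm_ne_top hGi) f.memLp.2.ne
  · refine (eLpNorm_weighted_integralFun_le ht.out hG (hGk k hH) f.differentiable
      κ.one_le_exponent).trans_eq ?_
    rw [mul_assoc, mul_comm (∫⁻ u, G u)]

/-- The operator `A_k` on the Fock space with label `κ`. -/
def integralOp [Fact (0 < t)] (κ : Kind) (hk : IsWienerKernel t k) : Op n t κ :=
  (exists_isIntegralOp κ hk).choose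

theorem isIntegralOp_integralOp [Fact (0 < t)] (κ : Kind) (hk : IsWienerKernel t k) :
    IsIntegralOp k (integralOp κ hk) := (exists_isIntegralOp κ hk).choose_spec

theorem IsIntegralOp.unique [Fact (0 < t)] {A B : Op n t κ} (hA : IsIntegralOp k A)
    (hB : IsIntegralOp k B) : A = B :=
  ContinuousLinearMap.ext fun f => FockSpace.ext fun z => (hA f z).trans (hB f z).symm

/-- Shifting an integral operator shifts its kernel. -/
theorem IsIntegralOp.shift [ht : Fact (0 < t)] {A : Op n t κ} (hA : IsIntegralOp k A)
    (x : Cn n) : IsIntegralOp (shiftKernel t x k) (shift x A) := by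
  intro f z
  have ht' := ht.out
  show normKernel t x z * A (weyl n t κ (-x) f) (z - x) = _
  rw [hA]
  show normKernel t x z * ∫ w, weylFun t (-x) f w * k w (z - x) ∂(gaussian n t) = _
  rw [integral_gaussian ht', integral_gaussian ht', ← integral_const_mul]
  rw [← integral_add_right_eq_self (fun w => _ * (f w * shiftKernel t x k w z)) x]
  refine integral_congr_ae (Eventually.of_forall fun u => ?_)
  have h := exp_mul_normKernel_neg ht' x u
  simp only [weylFun, shiftKernel, sub_neg_eq_add, add_sub_cancel_right]
  push_cast at h ⊢
  linear_combination normKernel t x z * f (u + x) * k u (z - x) *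
    ((Real.pi * t : ℂ) ^ n)⁻¹ * h

/-! ### Strong continuity -/

theorem weighted_sub (f g : Cn n → ℂ) : weighted t (f - g) = weighted t f - weighted t g := by
  funext z; simp [weighted, sub_mul]

/-- If the kernels `K x` are dominated by one function and converge uniformly on bounded sets after
weighting, then the operators `A_{K x}` converge strongly on every Fock space except `F_t^∞`. -/
theorem tendsto_integralOp [ht : Fact (0 < t)] (hκ : κ ≠ .infty) {X : Type*} {l : Filter X}
    {K : X → Cn n → Cn n → ℂ} {K₀ : Cn n → Cn n → ℂ} {A : X → Op n t κ} {A₀ : Op n t κ}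
    (hK : ∀ x, IsWienerKernel t (K x)) (hK₀ : IsWienerKernel t K₀)
    (hA : ∀ x, IsIntegralOp (K x) (A x)) (hA₀ : IsIntegralOp K₀ A₀) {H : Cn n → ℝ}
    (hH : ∀ x, Dominates t H (K x)) (hH₀ : Dominates t H K₀)
    (hlim : ∀ (R δ : ℝ), 0 < δ → ∀ᶠ x in l, ∀ w z : Cn n, ‖w‖ ≤ R → ‖z‖ ≤ R →
      ‖weightedKernel t (K x) w z - weightedKernel t K₀ w z‖ ≤ δ) (f : FockSpace n t κ) :
    Tendsto (fun x => A x f) l (𝓝 (A₀ f)) := by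
  have ht' := ht.out
  obtain ⟨G, hG, hGi, hGk⟩ := exists_measurable_majorant (t := t) hH₀.integrable
  obtain ⟨C, hC⟩ := f.exists_norm_weighted_le ht'
  set c : ℝ≥0∞ := ‖((Real.pi * t) ^ n)⁻¹‖ₑ with hc
  have hct : c ≠ ⊤ := enorm_ne_top
  set q := κ.exponent with hq
  set g : Cn n → ℝ≥0∞ := fun w => ‖weighted t f w‖ₑ with hg
  have hgm : Measurable g := measurable_enorm_weighted f.differentiable
  set G2 : Cn n → ℝ≥0∞ := fun u => G u + G u with hG2
  have hG2m : Measurable G2 := hG.add hG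
  have hG2i : ∫⁻ u, G2 u ≠ ⊤ := by
    rw [hG2, lintegral_add_left hG]
    exact ENNReal.add_ne_top.2 ⟨hGi, hGi⟩
  -- The Fock norm is a multiple of the `L^q` norm of the weighted function.
  suffices hmain : Tendsto (fun x => eLpNorm (weighted t (A x f - A₀ f : FockSpace n t κ)) q volume)
      l (𝓝 0) by
    rw [tendsto_iff_norm_sub_tendsto_zero]
    simp only [FockSpace.norm_eq]
    have h := ((ENNReal.tendsto_toReal ENNReal.zero_ne_top).comp hmain).const_mul (κ.factor n t)
    simpa using h
  have hpt : ∀ x z, ‖weighted t (A x f - A₀ f : FockSpace n t κ) z‖ₑ ≤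
      c * ∫⁻ w, g w * ‖weightedKernel t (K x) w z - weightedKernel t K₀ w z‖ₑ := by
    intro x z
    have e1 : (⇑(A x f) : Cn n → ℂ) = integralFun t (K x) f := funext fun z => hA x f z
    have e2 : (⇑(A₀ f) : Cn n → ℂ) = integralFun t K₀ f := funext fun z => hA₀ f z
    have e3 : (⇑(A x f - A₀ f : FockSpace n t κ) : Cn n → ℂ) =
      integralFun t (K x) f - integralFun t K₀ f := by rw [← e1, ← e2]; rfl
    rw [e3, weighted_sub, Pi.sub_apply, weighted_integralFun ht', weighted_integralFun ht',
      ← mul_sub, ← integral_sub (integrable_weighted_mul (hK x) f.differentiable hC z)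
        (integrable_weighted_mul hK₀ f.differentiable hC z), enorm_mul]
    refine mul_le_mul' (by simp [enorm, hc]) ?_
    refine (enorm_integral_le_lintegral_enorm _).trans_eq ?_
    simp only [← mul_sub, enorm_mul, hg]
  rw [ENNReal.tendsto_nhds_zero]
  intro ε hε
  have hε2 : 0 < ε / 2 := ENNReal.half_pos hε.ne'
  have h1 := ENNReal.Tendsto.const_mul (a := c) (f.tendsto_tail hκ hG2i) (Or.inr hct)
  rw [mul_zero] at h1
  -- First `R` makes the two tail terms small, then `δ` the contribution of the bounded set.
  obtain ⟨R, hR⟩ := ((ENNReal.tendsto_nhds_zero.1 h1) (ε / 2) hε2).exists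
  set I : ℝ≥0∞ := ∫⁻ w in Metric.closedBall (0 : Cn n) R, g w with hI
  have hIt : I ≠ ⊤ :=
    (f.continuous_weighted.continuousOn.integrableOn_compact (isCompact_closedBall _ _)).2.ne
  set V : ℝ≥0∞ := eLpNorm ((Metric.closedBall (0 : Cn n) (2 * R)).indicator
    fun _ => (1 : ℝ≥0∞)) q volume with hV
  have hVt : V ≠ ⊤ := by
    have := (memLp_indicator_const (μ := (volume : Measure (Cn n))) q
      (measurableSet_closedBall (x := (0 : Cn n)) (ε := 2 * R)) (1 : ℝ)
      (Or.inr measure_closedBall_lt_top.ne)).2.ne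
    refine ne_top_of_le_ne_top this (eLpNorm_mono_enorm fun z => ?_)
    by_cases hz : z ∈ Metric.closedBall (0 : Cn n) (2 * R) <;> simp [hz]
  have h2 : Tendsto (fun δ : ℝ => c * (I * ENNReal.ofReal δ * V)) (𝓝[>] 0) (𝓝 0) := by
    have h3 : Tendsto (fun δ : ℝ => ENNReal.ofReal δ) (𝓝[>] 0) (𝓝 0) := by
      have := ENNReal.continuous_ofReal.tendsto 0
      rw [ENNReal.ofReal_zero] at this
      exact this.mono_left nhdsWithin_le_nhds
    have h4 := ENNReal.Tendsto.const_mul (a := c) (ENNReal.Tendsto.mul_const (b := V)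
      (ENNReal.Tendsto.const_mul (a := I) h3 (Or.inr hIt)) (Or.inr hVt)) (Or.inr hct)
    simpa using h4
  obtain ⟨δ, hδ, hδ0⟩ :=
    (((ENNReal.tendsto_nhds_zero.1 h2) (ε / 2) hε2).and self_mem_nhdsWithin).exists
  filter_upwards [hlim (2 * R) δ hδ0] with x hx
  have hD : ∀ z, ∀ᵐ w, ‖weightedKernel t (K x) w z - weightedKernel t K₀ w z‖ₑ ≤ G2 (w - z) :=
    fun z => by
      filter_upwards [hGk _ (hH x) z, hGk _ hH₀ z] with w hw1 hw2
      exact (enorm_sub_le).trans (add_le_add hw1 hw2)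
  set F1 := conv ((far n R).indicator g) G2
  set F2 := conv g ((far n R).indicator G2)
  set F3 : Cn n → ℝ≥0∞ := (Metric.closedBall (0 : Cn n) (2 * R)).indicator
    fun _ => I * ENNReal.ofReal δ
  have hfar := measurableSet_far (n := n) R
  have hm1 : Measurable F1 := measurable_conv (hgm.indicator hfar) hG2m
  have hm2 : Measurable F2 := measurable_conv hgm (hG2m.indicator hfar)
  have hm3 : Measurable F3 := measurable_const.indicator measurableSet_closedBall
  have hle := eLpNorm_le_mul_of_enorm_le (F := F1 + F2 + F3) hct (fun z => (hpt x z).trans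
    (mul_le_mul_right (lintegral_mul_le_conv_far
      (fun w => ‖weightedKernel t (K x) w z - weightedKernel t K₀ w z‖ₑ)
      (R := R) (δ := ENNReal.ofReal δ) hgm hG2m z (hD z)
      (fun hz w hw => by
        rw [← ofReal_norm]
        refine ENNReal.ofReal_le_ofReal (hx w z ?_ hz)
        have : (0 : ℝ) ≤ R := Nat.cast_nonneg R
        linarith)) _)) q
  refine hle.trans ?_
  have hq1 : 1 ≤ q := κ.one_le_exponent
  have hb3 : eLpNorm F3 q volume ≤ I * ENNReal.ofReal δ * V := by
    have hne : I * ENNReal.ofReal δ ≠ ⊤ := ENNReal.mul_ne_top hIt ENNReal.ofReal_ne_top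
    have e : I * ENNReal.ofReal δ = ((I * ENNReal.ofReal δ).toNNReal : ℝ≥0∞) :=
      (ENNReal.coe_toNNReal hne).symm
    have := eLpNorm_le_nnreal_smul_eLpNorm_of_ae_le_mul' (μ := (volume : Measure (Cn n)))
      (f := F3) (g := (Metric.closedBall (0 : Cn n) (2 * R)).indicator fun _ => (1 : ℝ≥0∞))
      (c := (I * ENNReal.ofReal δ).toNNReal) (Eventually.of_forall fun z => by
        rw [← e]
        by_cases hz : z ∈ Metric.closedBall (0 : Cn n) (2 * R)
        · simp only [F3, Set.indicator_of_mem hz, enorm_eq_self, mul_one, le_refl]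
        · simp [F3, Set.indicator_of_notMem hz]) q
    rwa [ENNReal.smul_def, ← e, smul_eq_mul] at this
  have hb1 := eLpNorm_conv_le hq1 (hgm.indicator hfar) hG2m
  have hb2 := eLpNorm_conv_le hq1 hgm (hG2m.indicator hfar)
  have hsum : eLpNorm (F1 + F2 + F3) q volume ≤
      eLpNorm F1 q volume + eLpNorm F2 q volume + eLpNorm F3 q volume :=
    (eLpNorm_add_le (hm1.add hm2).aestronglyMeasurable hm3.aestronglyMeasurable hq1).trans
      (add_le_add_left (eLpNorm_add_le hm1.aestronglyMeasurable hm2.aestronglyMeasurable hq1) _)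
  have hg' : eLpNorm g q volume = eLpNorm (weighted t f) q volume := eLpNorm_enorm _
  rw [hg'] at hb2
  calc c * eLpNorm (F1 + F2 + F3) q volume
      ≤ c * (eLpNorm F1 q volume + eLpNorm F2 q volume + eLpNorm F3 q volume) :=
        mul_le_mul_right hsum _
    _ ≤ c * (_ + _ + I * ENNReal.ofReal δ * V) :=
        mul_le_mul_right (add_le_add (add_le_add hb1 hb2) hb3) _
    _ ≤ ε / 2 + ε / 2 := by
        rw [mul_add]
        exact add_le_add hR hδ
    _ = ε := ENNReal.add_halves ε

/-! ### Adjoints and the pairing -/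

/-- The kernel of the adjoint of `A_k` with respect to the pairing. -/
def adjointKernel (k : Cn n → Cn n → ℂ) (w z : Cn n) : ℂ := conj (k z w)

theorem IsWienerKernel.adjointKernel (hk : IsWienerKernel t k) :
    IsWienerKernel t (adjointKernel k) where
  measurable := Complex.continuous_conj.measurable.comp (hk.measurable.comp measurable_swap)
  holomorphic w := hk.antiholomorphic w
  antiholomorphic z := by
    simpa only [Fock.adjointKernel, Complex.conj_conj] using hk.holomorphic z
  dominated := by
    obtain ⟨H, hH⟩ := hk.dominated
    refine ⟨fun u => H (-u), fun u => hH.nonneg _, hH.integrable.comp_neg, fun w z => ?_⟩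
    rw [Fock.adjointKernel, RCLike.norm_conj, neg_sub, add_comm]
    exact hH.bound z w

theorem weightedKernel_adjointKernel (w z : Cn n) :
    weightedKernel t (adjointKernel k) w z = conj (weightedKernel t k z w) := by
  rw [weightedKernel, weightedKernel, adjointKernel, map_mul, Complex.conj_ofReal,
    add_comm (‖z‖ ^ 2)]

theorem pairing_eq (ht : 0 < t) (f g : Cn n → ℂ) : pairing t f g =
    ((((Real.pi * t) ^ n)⁻¹ : ℝ) : ℂ) * ∫ w, weighted t f w * conj (weighted t g w) := by
  rw [pairing, integral_gaussian ht, ← integral_const_mul]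
  refine integral_congr_ae (Eventually.of_forall fun w => ?_)
  have e : Real.exp (-‖w‖ ^ 2 / t) =
      Real.exp (-‖w‖ ^ 2 / (2 * t)) * Real.exp (-‖w‖ ^ 2 / (2 * t)) := by
    rw [← Real.exp_add]; congr 1; field_simp; ring
  simp only [e, weighted, map_mul, Complex.conj_ofReal]
  push_cast
  ring

theorem pairing_conj_symm (f g : Cn n → ℂ) : conj (pairing t f g) = pairing t g f := by
  rw [pairing, pairing, ← integral_conj]
  simp only [map_mul, Complex.conj_conj, mul_comm]

/-- Fubini's theorem turns the adjoint kernel into the adjoint operator. -/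
theorem pairing_integralFun (ht : 0 < t) (hk : IsWienerKernel t k) {f : Cn n → ℂ}
    (hf : Differentiable ℂ f) {C : ℝ} (hC : ∀ z, ‖weighted t f z‖ ≤ C)
    (g : FockSpace n t (.pow 1 le_rfl)) :
    pairing t (integralFun t k f) g = pairing t f (integralFun t (adjointKernel k) g) := by
  obtain ⟨H, hH⟩ := hk.dominated
  have hgi : Integrable (weighted t g) := by
    have := g.memLp
    rwa [Kind.exponent, ENNReal.ofReal_one, memLp_one_iff_integrable] at this
  have hint : Integrable (fun p : Cn n × Cn n =>
      weighted t f p.1 * weightedKernel t k p.1 p.2 * conj (weighted t g p.2))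
      (volume.prod volume) := by
    have h1 := (hgi.norm.convolution_integrand (ContinuousLinearMap.mul ℝ ℝ)
      hH.integrable).const_mul C
    refine h1.mono' ?_ (Eventually.of_forall fun p => ?_)
    · have hfm := (continuous_weighted (t := t) hf).measurable
      have hgm := g.continuous_weighted.measurable
      have hkm : Measurable fun p : Cn n × Cn n => weightedKernel t k p.1 p.2 :=
        measurable_weightedKernel hk.measurable
      exact (((hfm.comp measurable_fst).mul hkm).mul (Complex.continuous_conj.measurable.comp
        (hgm.comp measurable_snd))).aestronglyMeasurable
    · rw [norm_mul, norm_mul, RCLike.norm_conj, mul_assoc]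
      simp only [ContinuousLinearMap.mul_apply']
      rw [mul_comm ‖weighted t g p.2‖]
      exact mul_le_mul (hC _) (mul_le_mul_of_nonneg_right (hH.norm_weightedKernel_le _ _)
        (norm_nonneg _)) (by positivity) ((norm_nonneg _).trans (hC 0))
  -- The majorant `C H(w - z) |g(z)|` is integrable on the product, as in a convolution.
  have hswap := integral_integral_swap (f := fun w z =>
    weighted t f w * weightedKernel t k w z * conj (weighted t g z)) hint
  rw [pairing_eq ht, pairing_eq ht]
  congr 1
  simp only [weighted_integralFun ht, map_mul, Complex.conj_ofReal, ← integral_conj,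
    weightedKernel_adjointKernel, Complex.conj_conj]
  simp only [mul_assoc, mul_left_comm _ ((((Real.pi * t) ^ n)⁻¹ : ℝ) : ℂ), integral_const_mul]
  congr 1
  simp only [← integral_mul_const, ← integral_const_mul]
  rw [← hswap]
  refine integral_congr_ae (Eventually.of_forall fun w => ?_)
  refine integral_congr_ae (Eventually.of_forall fun z => ?_)
  simp only
  ring

theorem norm_weighted_one (z : Cn n) :
    ‖weighted t (1 : Cn n → ℂ) z‖ = Real.exp (-(1 / (2 * t)) * ‖z‖ ^ 2) := by
  rw [norm_weighted, Pi.one_apply, norm_one, one_mul]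
  congr 1
  ring

theorem growth_one (ht : 0 < t) (hκ : κ ≠ .infty) : Growth n t κ 1 := by
  cases κ with
  | infty => exact absurd rfl hκ
  | pow p hp =>
    have : 0 < p := by linarith
    simpa [Growth] using integrable_exp_neg_norm_sq (n := n) (b := p / (2 * t)) (by positivity)
  | vanish =>
    rw [growth_vanish_iff, tendsto_zero_iff_norm_tendsto_zero]
    simp only [norm_weighted_one]
    have h1 : Tendsto (fun z : Cn n => 1 / (2 * t) * ‖z‖ ^ 2) (cocompact (Cn n)) atTop :=
      ((tendsto_pow_atTop two_ne_zero).comp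
        (tendsto_norm_cocompact_atTop (E := Cn n))).const_mul_atTop
        (by positivity)
    refine (Real.tendsto_exp_neg_atTop_nhds_zero.comp h1).congr fun z => ?_
    simp

/-- The normalized reproducing kernels `k_z = W_z 1`, as elements of the Fock spaces other than
`F_t^∞`. -/
def kernelVector [ht : Fact (0 < t)] (hκ : κ ≠ .infty) (z : Cn n) : FockSpace n t κ :=
  weyl n t κ z ⟨1, differentiable_const (1 : ℂ), growth_one ht.out hκ⟩

theorem coe_kernelVector [ht : Fact (0 < t)] (hκ : κ ≠ .infty) (z : Cn n) :
    (⇑(kernelVector (t := t) hκ z) : Cn n → ℂ) = normKernel t z :=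
  funext fun w => mul_one (normKernel t z w)

/-- Functions in Fock spaces are determined by their pairings with the normalized kernels. -/
theorem FockSpace.eq_of_pairing_normKernel [ht : Fact (0 < t)] {f g : FockSpace n t κ}
    (h : ∀ z, pairing t f (normKernel t z) = pairing t g (normKernel t z)) : f = g := by
  obtain ⟨C, hC⟩ := f.exists_norm_weighted_le ht.out
  obtain ⟨D, hD⟩ := g.exists_norm_weighted_le ht.out
  refine FockSpace.ext fun z => ?_
  have h1 := h z
  rw [pairing_normKernel f.differentiable hC, pairing_normKernel g.differentiable hD] at h1
  have h2 : ((gaussian n t).real Set.univ : ℂ) ≠ 0 :=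
    Complex.ofReal_ne_zero.2 (gaussian_real_univ_ne_zero n t)
  exact mul_left_cancel₀ (Complex.exp_ne_zero _) (mul_left_cancel₀ h2 h1)

theorem IsBiadjoint.unique [ht : Fact (0 < t)] {B₀ : Op n t .vanish} {B B' : Op n t .infty}
    (h : IsBiadjoint B₀ B) (h' : IsBiadjoint B₀ B') : B = B' := by
  obtain ⟨C, hC, hB⟩ := h
  obtain ⟨C', hC', hB'⟩ := h'
  -- The first adjoint is determined by pairing with the kernels in `f_t^∞`, the second one by
  -- pairing with the kernels in `F_t^1`.
  have hCC : C = C' := by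
    refine ContinuousLinearMap.ext fun g => FockSpace.eq_of_pairing_normKernel fun z => ?_
    have h1 := (hC (kernelVector (by simp) z) g).symm.trans (hC' (kernelVector (by simp) z) g)
    rw [coe_kernelVector] at h1
    rw [← pairing_conj_symm, h1, pairing_conj_symm]
  subst hCC
  refine ContinuousLinearMap.ext fun f => FockSpace.eq_of_pairing_normKernel fun z => ?_
  have h1 := (hB f (kernelVector (by simp) z)).trans (hB' f (kernelVector (by simp) z)).symm
  rwa [coe_kernelVector] at h1

/-- The same kernel gives on `F_t^∞` the biadjoint of its operator on `f_t^∞`; the operator on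
`F_t^1` in between has the adjoint kernel. -/
theorem isBiadjoint_integralOp [ht : Fact (0 < t)] (hk : IsWienerKernel t k) :
    IsBiadjoint (integralOp .vanish hk) (integralOp .infty hk) := by
  have hcoe : ∀ {κ : Kind} {k : Cn n → Cn n → ℂ} (hk : IsWienerKernel t k) (f : FockSpace n t κ),
      (⇑(integralOp κ hk f) : Cn n → ℂ) = integralFun t k f :=
    fun hk f => funext fun z => isIntegralOp_integralOp _ hk f z
  refine ⟨integralOp _ hk.adjointKernel, fun f g => ?_, fun f g => ?_⟩ <;>
  · obtain ⟨C, hC⟩ := f.exists_norm_weighted_le ht.out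
    rw [hcoe, hcoe]
    exact pairing_integralFun ht.out hk f.differentiable hC g

/-! ### Limit operators -/

theorem IsStrongExtension.unique [Fact (0 < t)] {A : Op n t κ}
    {Ψ Ψ' : MaxIdealSpace n → Op n t κ} (h : IsStrongExtension A Ψ)
    (h' : IsStrongExtension A Ψ') : Ψ = Ψ' := by
  funext x
  refine ContinuousLinearMap.ext fun f => ?_
  have := (denseRange_evalAt n).equalizer (h.continuous f) (h'.continuous f)
    (funext fun z => by simp only [Function.comp_apply, h.extends_shift, h'.extends_shift])
  exact congrFun this x

theorem RestrictsTo.unique [Fact (0 < t)] {A : Op n t .infty} {A₀ A₀' : Op n t .vanish}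
    (h : RestrictsTo A A₀) (h' : RestrictsTo A A₀') : A₀ = A₀' := by
  refine ContinuousLinearMap.ext fun f => FockSpace.ext fun z => ?_
  let F : FockSpace n t .infty :=
    ⟨f, f.differentiable, f.growth.infty_of_vanish f.differentiable⟩
  exact (h F f (fun _ => rfl) z).symm.trans (h' F f (fun _ => rfl) z)

/-- On `F_t^∞`, the restriction of `A`, its strong extension and the biadjoints are each unique. -/
theorem IsLimitFamily.unique [Fact (0 < t)] {A : Op n t κ}
    {Ψ Ψ' : MaxIdealSpace n → Op n t κ} (h : IsLimitFamily A Ψ) (h' : IsLimitFamily A Ψ') :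
    Ψ = Ψ' := by
  cases κ with
  | pow p hp => exact IsStrongExtension.unique h h'
  | vanish => exact IsStrongExtension.unique h h'
  | infty =>
    obtain ⟨A₀, Ψ₀, hA, hΨ, hb⟩ := h
    obtain ⟨A₀', Ψ₀', hA', hΨ', hb'⟩ := h'
    obtain rfl := hA.unique hA'
    obtain rfl := hΨ.unique hΨ'
    exact funext fun x => (hb x).unique (hb' x)

theorem isWienerKernel_limitKernel (ht : 0 < t) (hk : IsBoundedKernel t M k)
    (hw : IsWienerKernel t k) (x : MaxIdealSpace n) : IsWienerKernel t (limitKernel ht hk x) := by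
  obtain ⟨H, hH⟩ := hw.dominated
  exact (isBoundedKernel_limitKernel ht hk x).isWienerKernel ht (hH.limitKernel ht hk x)

/-- On the Fock spaces other than `F_t^∞`, the operators with the limit kernels form the strongly
continuous extension of the shifts. -/
theorem isStrongExtension_limitKernel [ht : Fact (0 < t)] (hκ : κ ≠ .infty) {A : Op n t κ}
    (hk : IsBoundedKernel t M k) (hw : IsWienerKernel t k) (hA : IsIntegralOp k A) :
    IsStrongExtension A fun x => integralOp κ (isWienerKernel_limitKernel ht.out hk hw x) where
  -- The character `evalAt z` evaluates at `z`, so its limit kernel is `shiftKernel t z k` by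
  -- definition.
  extends_shift z := (isIntegralOp_integralOp κ _).unique (hA.shift z)
  continuous f := by
    obtain ⟨H, hH⟩ := hw.dominated
    refine continuous_iff_continuousAt.2 fun y => ?_
    exact tendsto_integralOp hκ (fun x => isWienerKernel_limitKernel ht.out hk hw x)
      (isWienerKernel_limitKernel ht.out hk hw y) (fun x => isIntegralOp_integralOp κ _)
      (isIntegralOp_integralOp κ _) (fun x => hH.limitKernel ht.out hk x)
      (hH.limitKernel ht.out hk y)
      (fun R δ hδ => eventually_norm_weightedKernel_limitKernel_sub_le ht.out hk y R hδ) f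

theorem isLimitFamily_limitKernel [ht : Fact (0 < t)] {A : Op n t κ}
    (hk : IsBoundedKernel t M k) (hw : IsWienerKernel t k) (hA : IsIntegralOp k A) :
    IsLimitFamily A fun x => integralOp κ (isWienerKernel_limitKernel ht.out hk hw x) := by
  cases κ with
  | pow p hp => exact isStrongExtension_limitKernel (by simp) hk hw hA
  | vanish => exact isStrongExtension_limitKernel (by simp) hk hw hA
  | infty =>
    refine ⟨integralOp .vanish hw, _, fun f f₀ hf z => ?_,
      isStrongExtension_limitKernel (by simp) hk hw (isIntegralOp_integralOp _ hw),
      fun x => isBiadjoint_integralOp _⟩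
    rw [hA, isIntegralOp_integralOp]
    simp only [hf]

end Fock

end

theorem mainTheorem9 (n : ℕ) (t : ℝ) [Fact (0 < t)] (κ : Fock.Kind) (A : Fock.Op n t κ)
    (hA : A ∈ Fock.wienerOps n t κ) :
    ∃ α : Fock.MaxIdealSpace n → Fock.Op n t κ,
      Fock.IsLimitFamily A α ∧
      (∀ α' : Fock.MaxIdealSpace n → Fock.Op n t κ, Fock.IsLimitFamily A α' → α' = α) ∧
      ∀ x ∈ Fock.boundary n,
        α x ∈ Fock.wienerOps n t κ ∧
        ∀ k : Fock.Cn n → Fock.Cn n → ℂ, Fock.IsWienerKernel t k → Fock.IsIntegralOp k A →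
          ∃ kx : Fock.Cn n → Fock.Cn n → ℂ,
            Fock.IsWienerKernel t kx ∧ Fock.IsIntegralOp kx (α x) ∧
            ∀ H : Fock.Cn n → ℝ, Fock.Dominates t H k → Fock.Dominates t H kx := by
  have ht : 0 < t := Fact.out
  obtain ⟨k₀, hk₀, hAk₀⟩ := hA
  obtain ⟨H₀, hH₀⟩ := hk₀.dominated
  have hb₀ := hH₀.isBoundedKernel ht hk₀
  have hα := Fock.isLimitFamily_limitKernel hb₀ hk₀ hAk₀
  refine ⟨_, hα, fun α' hα' => hα'.unique hα, fun x _ =>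
    ⟨⟨_, Fock.isWienerKernel_limitKernel ht hb₀ hk₀ x, Fock.isIntegralOp_integralOp κ _⟩,
      fun k hk hAk => ?_⟩⟩
  -- Another kernel of `A` has limit kernels of its own; uniqueness of the limit family shows
  -- that they represent the same operators.
  obtain ⟨H₁, hH₁⟩ := hk.dominated
  have hb := hH₁.isBoundedKernel ht hk
  have hβ := Fock.isLimitFamily_limitKernel hb hk hAk
  refine ⟨Fock.limitKernel ht hb x, Fock.isWienerKernel_limitKernel ht hb hk x, ?_,
    fun H hH => hH.limitKernel ht hb x⟩
  rw [congrFun (hα.unique hβ) x]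
  exact Fock.isIntegralOp_integralOp κ _
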